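/- **Setting.** A semi-ring SPJA query over a natural join is given as an annotated junction hypertree: a finite tree $(V,E)$ whose vertices (bags) are finite sets of attributes, such that for every attribute the bags containing it form a connected subtree. Each bag $u$ carries exactly one non-empty relation $R_u$ with schema $u$, whose tuples are distinct, annotated with elements of a commutative semi-ring, and stored in lexicographic order with respect to one fixed order of the attributes (the index that the join algorithm needs). Selections annotated on $u$ only read attributes of $u$; $s(u)$ is their combined selectivity, so $s(u)|R_u|$ tuples are selected. Group-by annotations $\gamma_A$ and cancelling marginalization annotations $\sum_A$ are placed on bags containing $A$, each $\gamma_A$ on only one bag; the query groups by the attributes that have a $\gamma_A$ and no $\sum_A$ annotation. No relation is excluded. Every attribute has at most $d$ values. **Execution.** Time is counted in unit-cost RAM steps (array accesses, comparisons, semi-ring operations, evaluating the selections of a bag on a tuple, reading or writing an attribute value; hash table operations take constant time once the key has been read). The naive execution filters all relations, joins them by Leapfrog Triejoin (with an immediate empty answer if an input is empty) and aggregates by hashing. Upward message passing to a root $r\in V$ computes, from the leaves to the root, for each edge $u\to v$ towards $r$ the message of $u$: the Leapfrog Triejoin of the selected $R_u$ with the messages received by $u$, aggregated by hashing onto $(u\cap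 v)\cup\Gamma(u,v)$ and sorted, where $\Gamma(u,v)$ is the set of attributes with a $\gamma$ annotation at $u$ or upstream of $u$ that is not cancelled at $u$ or on the way to $u$; finally it absorbs at $r$ (joins the selected $R_r$ with all messages received) and aggregates to the group-by attributes of the query. **Notation.** For $v\in V\cup\{\varnothing\}$ let $U(u,v)=\{i\ne v : \{i,u\}\in E\}$, let $g(u,v)$ be the number of attributes in $\bigcup_{x\in U(u,v)}\Gamma(x,u)$ that are not in $u$, let $\mathcal S(u,v)=d^{\,g(u,v)}s(u)|R_u|$, and $$\mathcal M(u,v)=(|U(u,v)|+1)\,(|u|+g(u,v))\,\mathcal S(u,v)\,\log\Bigl(1+\max\bigl(\max_{x\in U(u,v)}\mathcal S(x,u),\ s(u)|R_u|\bigr)\Bigr).$$ Let $Tra(r)$ be the set of directed edges $u\to v$ pointing towards $r$. Let $\rho$ be the fractional edge cover bound of the join of the selected relations: the infimum of $\prod_{v}(s(v)|R_v|)^{x_v}$ over all $x\ge 0$ with $\sum_{v\ni A}x_v\ge 1$ for every attribute $A\in\bigcup_{v\in V}v$. **Proposition (Runtime Complexity).** There is an absolute constant $C>0$ such that for all such queries: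 1. naive execution takes at most $C\Bigl(|V|\cdot\bigl|\bigcup_{v\in V}v\bigr|\cdot\rho\cdot\log\bigl(1+\max_{v\in V}s(v)|R_v|\bigr)+\sum_{v\in V}|R_v|\Bigr)$ steps; 2. for every directed edge $u\to v$, the message from $u$ to $v$ has at most $\mathcal S(u,v)$ tuples; 3. for every root $r\in V$, message passing to $r$ takes at most $C\sum_{(u,v)\in Tra(r)\cup\{(r,\varnothing)\}}\bigl(\mathcal M(u,v)+|R_u|\bigr)$ steps. -/

import Mathlib

/-!
Cost model: a unit-cost random access machine.  A program is written in the monad `Steps`, whose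
values carry the number of elementary operations performed.  Unit cost is charged for a probe of a
stored array (read, compare, update the index), a loop or call step, a semiring operation, the
evaluation of the selection predicate of a bag on a tuple, and reading or writing one attribute
value of a tuple.  An operation of a hash table costs constant time once its key has been read.
The schemas (which columns a table has, which of them are kept) belong to the query plan.
-/

/-- A value together with the number of machine steps spent to compute it. -/
structure Steps (α : Type) where
  val : α
  time : ℕ

namespace Steps

instance : Monad Steps where
  pure a := ⟨a, 0⟩
  bind x f := ⟨(f x.val).val, x.time + (f x.val).time⟩

/-- Spend `n` steps. -/
def tick (n : ℕ) : Steps Unit := ⟨(), n⟩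

end Steps

namespace SPJA

open Steps

/-- A tuple: attribute values are encoded as natural numbers (machine words).  A tuple over a schema
`S` is only ever read at the attributes of `S`. -/
abbrev Row (A : Type) := A → ℕ

/-- The vector of values of a tuple over the schema `S`, in the order of the attributes. -/
def keyOf {A : Type} [LinearOrder A] (S : Finset A) (t : Row A) : List ℕ :=
  (S.sort (· ≤ ·)).map t

/-- An annotated relation: a schema and a random access array of annotated tuples. -/
structure Table (A K : Type) where
  attrs : Finset A
  rows : List (Row A × K)

/-- The value of attribute `a` in the `i`-th tuple. -/
def Table.cell {A K : Type} (T : Table A K) (a : A) (i : ℕ) : ℕ :=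
  match T.rows[i]? with
  | some r => r.1 a
  | none => 0

/-- The annotation of the `i`-th tuple. -/
def Table.ann {A K : Type} [CommSemiring K] (T : Table A K) (i : ℕ) : K :=
  match T.rows[i]? with
  | some r => r.2
  | none => 0

/-! ### Leapfrog triejoin

The trie of a relation is its array of tuples, sorted lexicographically: a node of the trie is a
block `[pos, hi)` of consecutive tuples that agree on the attributes bound so far. -/

/-- A trie iterator: the not yet visited part `[pos, hi)` of a block of a sorted table. -/
structure Cursor (A K : Type) where
  table : Table A K
  pos : ℕ
  hi : ℕ

/-- Binary search in `[lo, hi)` for the first index whose key is at least `x`. -/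
def lowerBound (key : ℕ → ℕ) (x lo hi : ℕ) : Steps ℕ :=
  if lo < hi then do
    tick 1
    if key ((lo + hi) / 2) < x then lowerBound key x ((lo + hi) / 2 + 1) hi
    else lowerBound key x lo ((lo + hi) / 2)
  else do
    tick 1
    pure lo
termination_by hi - lo

/-- One round of the leapfrog search for the attribute `a`: each iterator over a table with the
attribute `a`, in turn, seeks the largest value reached so far (at first `x`).  Returns the largest
value reached and the iterators in their new positions, or `none` if an iterator is at its end. -/
def leapfrogRound {A K : Type} [LinearOrder A] (a : A) :
    ℕ → List (Cursor A K) → Steps (Option (ℕ × List (Cursor A K)))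
  | x, [] => do
    tick 1
    pure (some (x, []))
  | x, c :: cs => do
    tick 1
    if a ∈ c.table.attrs then
      let i ← lowerBound (c.table.cell a) x c.pos c.hi
      if i < c.hi then
        let r ← leapfrogRound a (c.table.cell a i) cs
        pure (r.map fun p => (p.1, { c with pos := i } :: p.2))
      else
        pure none
    else
      let r ← leapfrogRound a x cs
      pure (r.map fun p => (p.1, c :: p.2))

/-- All iterators over tables with the attribute `a` stand at the value `x`.  Returns for each
iterator the block of the tuples with value `x` (one level down in the trie) and the iterator moved
past this block; iterators over other tables are unchanged. -/
def openBlocks {A K : Type} [LinearOrder A] (a : A) (x : ℕ) :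
    List (Cursor A K) → Steps (List (Cursor A K × Cursor A K))
  | [] => do
    tick 1
    pure []
  | c :: cs => do
    tick 1
    if a ∈ c.table.attrs then
      let i ← lowerBound (c.table.cell a) (x + 1) c.pos c.hi
      let r ← openBlocks a x cs
      pure (({ c with hi := i }, { c with pos := i }) :: r)
    else
      let r ← openBlocks a x cs
      pure ((c, c) :: r)

/-- The leapfrog join at one level of the tries: runs `body x` on every value `x` of the attribute
`a` that all iterators have in common, with the iterators one level down.  The first argument bounds
the number of rounds, `x` is the least value not yet excluded. -/
def leapfrog {A K : Type} [LinearOrder A] (a : A)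
    (body : ℕ → List (Cursor A K) → Steps (List (Row A × K))) :
    ℕ → ℕ → List (Cursor A K) → Steps (List (Row A × K))
  | 0, _, _ => pure []
  | n + 1, x, cs => do
    tick 1
    let r ← leapfrogRound a x cs
    match r with
    | none => pure []
    | some (y, cs') =>
      if y = x then
        let bs ← openBlocks a x cs'
        let out ← body x (bs.map Prod.fst)
        let rest ← leapfrog a body n (x + 1) (bs.map Prod.snd)
        pure (out ++ rest)
      else
        leapfrog a body n y cs'

/-- Every round but the last one reaches a new value or opens the blocks of a value, and each value
is the key of a tuple; so this number of rounds is never exhausted. -/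
def roundBound {A K : Type} (cs : List (Cursor A K)) : ℕ :=
  2 * (cs.map fun c => c.hi - c.pos).sum + 2

/-- The product of the annotations of the tuples that the iterators stand at. -/
def annProduct {A K : Type} [CommSemiring K] : List (Cursor A K) → Steps K
  | [] => do
    tick 1
    pure 1
  | c :: cs => do
    tick 1
    let k ← annProduct cs
    pure (c.table.ann c.pos * k)

/-- Backtracking search over the attributes: `t` binds the attributes before those of the list. -/
def trieJoin {A K : Type} [LinearOrder A] [CommSemiring K] :
    List A → Row A → List (Cursor A K) → Steps (List (Row A × K))
  | [], t, cs => do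
    let k ← annProduct cs
    pure [(t, k)]
  | a :: as, t, cs =>
    leapfrog a (fun x cs' => trieJoin as (Function.update t a x) cs') (roundBound cs) 0 cs

/-- The attributes of a natural join. -/
def joinAttrs {A K : Type} [LinearOrder A] (ts : List (Table A K)) : Finset A :=
  ts.foldr (fun T S => T.attrs ∪ S) ∅

/-- Leapfrog triejoin: the natural join of tables sorted in the order of the attributes.  The result
is empty at once if a table is empty; every output tuple is written attribute by attribute. -/
def leapfrogTriejoin {A K : Type} [LinearOrder A] [CommSemiring K] (ts : List (Table A K)) :
    Steps (List (Row A × K)) := do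
  tick ts.length
  if ts.any (fun T => T.rows.isEmpty) then
    pure []
  else
    let out ← trieJoin ((joinAttrs ts).sort (· ≤ ·)) (fun _ => 0)
      (ts.map fun T => ⟨T, 0, T.rows.length⟩)
    tick ((joinAttrs ts).card * out.length)
    pure out

/-! ### Hash-based aggregation and sorting -/

/-- The content of a hash table with keys over the schema `S` after the annotation of `r` has been
added to the entry of its key (a new entry if there is none). -/
def hashInsert {A K : Type} [LinearOrder A] [CommSemiring K] (S : Finset A) (r : Row A × K) :
    List (Row A × K) → List (Row A × K)
  | [] => [(fun a => if a ∈ S then r.1 a else 0, r.2)]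
  | e :: es =>
    if keyOf S e.1 = keyOf S r.1 then (e.1, e.2 + r.2) :: es else e :: hashInsert S r es

/-- Hash-based aggregation: group by the attributes `S` and sum up the annotations, starting from the
given content of the hash table. -/
def hashAggregate {A K : Type} [LinearOrder A] [CommSemiring K] (S : Finset A) :
    List (Row A × K) → List (Row A × K) → Steps (List (Row A × K))
  | table, [] => do
    tick 1
    pure table
  | table, r :: rs => do
    tick (S.card + 1)
    hashAggregate S (hashInsert S r table) rs

/-- Merge two sorted arrays; a comparison reads up to `S.card` values of each tuple. -/
def mergeRows {A K : Type} [LinearOrder A] (S : Finset A) :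
    List (Row A × K) → List (Row A × K) → Steps (List (Row A × K))
  | [], qs => do
    tick (qs.length + 1)
    pure qs
  | p :: ps, [] => do
    tick (ps.length + 1)
    pure (p :: ps)
  | p :: ps, q :: qs => do
    tick (S.card + 1)
    if keyOf S p.1 ≤ keyOf S q.1 then
      let l ← mergeRows S ps (q :: qs)
      pure (p :: l)
    else
      let l ← mergeRows S (p :: ps) qs
      pure (q :: l)
termination_by ps qs => ps.length + qs.length

/-- Merge sort, lexicographically with respect to the attributes `S`. -/
def sortRows {A K : Type} [LinearOrder A] (S : Finset A) (l : List (Row A × K)) :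
    Steps (List (Row A × K)) :=
  if l.length ≤ 1 then do
    tick 1
    pure l
  else do
    tick l.length
    let l₁ ← sortRows S (l.take (l.length / 2))
    let l₂ ← sortRows S (l.drop (l.length / 2))
    mergeRows S l₁ l₂
termination_by l.length
decreasing_by
  all_goals simp only [List.length_take, List.length_drop]; omega

/-- Scan an array and keep the tuples that satisfy a predicate. -/
def filterRows {A K : Type} (P : Row A → Bool) : List (Row A × K) → Steps (List (Row A × K))
  | [] => do
    tick 1
    pure []
  | r :: rs => do
    tick 1
    let l ← filterRows P rs
    pure (if P r.1 then r :: l else l)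

/-- Collect the results of a computation along a list. -/
def gather {V β : Type} (f : V → Steps β) : List V → Steps (List β)
  | [] => do
    tick 1
    pure []
  | v :: vs => do
    tick 1
    let b ← f v
    let bs ← gather f vs
    pure (b :: bs)

/-! ### SPJA queries as annotated junction hypertrees -/

/-- A semi-ring select-project-join-aggregate query over an acyclic natural join, given as an
annotated junction hypertree with one relation per bag.  The schema of the relation of a bag is the
bag, so that vertex and edge coverage hold by construction. -/
structure Query (V A K : Type) [Fintype V] [LinearOrder A] [CommSemiring K] where
  /-- the tree on the bags -/
  tree : SimpleGraph V
  decAdj : DecidableRel tree.Adj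
  isTree : tree.IsTree
  /-- the attributes of a bag -/
  bag : V → Finset A
  running_intersection : ∀ a, (tree.induce {v | a ∈ bag v}).Preconnected
  /-- the domains of the attributes -/
  dom : A → Finset ℕ
  /-- the annotated tuples of the relation of a bag, as stored -/
  rel : V → List (Row A × K)
  rel_nonempty : ∀ u, rel u ≠ []
  rel_dom : ∀ u, ∀ r ∈ rel u, ∀ a ∈ bag u, r.1 a ∈ dom a
  /-- the tuples of a relation are distinct, and stored in lexicographic order -/
  rel_sorted : ∀ u, (rel u).Pairwise fun r r' => keyOf (bag u) r.1 < keyOf (bag u) r'.1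
  /-- the conjunction of the selections annotated on a bag -/
  sel : V → Row A → Bool
  sel_local : ∀ u t t', (∀ a ∈ bag u, t a = t' a) → sel u t = sel u t'
  /-- the attributes `A` with a group-by annotation `γ_A` on a bag -/
  grp : V → Finset A
  grp_subset : ∀ u, grp u ⊆ bag u
  /-- each group-by attribute is annotated on exactly one bag -/
  grp_disjoint : ∀ u v, u ≠ v → Disjoint (grp u) (grp v)
  /-- the attributes `A` with a marginalization annotation `∑_A` on a bag, which cancels `γ_A` -/
  marg : V → Finset A
  marg_subset : ∀ u, marg u ⊆ bag u

attribute [instance] Query.decAdj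

namespace Query

variable {V A K : Type} [Fintype V] [LinearOrder V] [LinearOrder A] [CommSemiring K]

/-- The attributes of the query, i.e. the union of all bags. -/
def attrs (Q : Query V A K) : Finset A := Finset.univ.biUnion Q.bag

/-- The group-by attributes of the query. -/
def groupBy (Q : Query V A K) : Finset A :=
  Finset.univ.biUnion Q.grp \ Finset.univ.biUnion Q.marg

/-- Apply the selections of the bag `u` to its relation. -/
def select (Q : Query V A K) (u : V) : Steps (Table A K) := do
  let l ← filterRows (Q.sel u) (Q.rel u)
  pure ⟨Q.bag u, l⟩

/-- Naive execution: apply the selections, join all relations, aggregate. -/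
def naive (Q : Query V A K) : Steps (List (Row A × K)) := do
  let ts ← gather Q.select (Finset.univ.sort (· ≤ ·))
  let out ← leapfrogTriejoin ts
  hashAggregate Q.groupBy [] out

/-- `U(u, p)`: the neighbours of `u` except `p` (all neighbours if `p` is `none`, i.e. `∅`). -/
def inNbrs (Q : Query V A K) (u : V) (p : Option V) : Finset V :=
  Finset.univ.filter fun i => Q.tree.Adj i u ∧ some i ≠ p

/-- The group-by attributes in force on the messages that `u` sends towards `p`: those annotated on
`u` or in force on a message that `u` receives, unless cancelled at `u`.  The first argument bounds
the depth of the recursion into the tree. -/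
def carried (Q : Query V A K) : ℕ → V → Option V → Finset A
  | 0, _, _ => ∅
  | n + 1, u, p =>
    (Q.grp u ∪ (Q.inNbrs u p).biUnion fun i => Q.carried n i (some u)) \ Q.marg u

/-- The schema of the message `u → v`: all other attributes are marginalized out. -/
def messageAttrs (Q : Query V A K) (n : ℕ) (u v : V) : Finset A :=
  (Q.bag u ∩ Q.bag v) ∪ Q.carried n u (some v)

/-- Turn the join `out` computed at `u` into the message `u → v`: aggregate, then sort. -/
def emit (Q : Query V A K) (n : ℕ) (u v : V) (out : List (Row A × K)) : Steps (Table A K) := do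
  let l ← hashAggregate (Q.messageAttrs n u v) [] out
  let l' ← sortRows (Q.messageAttrs n u v) l
  pure ⟨Q.messageAttrs n u v, l'⟩

/-- The join of the selected relation of `u` with the messages of all its neighbours except `p`
(which are computed first, recursively); for `p = none` this is the absorption at `u`. -/
def absorb (Q : Query V A K) : ℕ → V → Option V → Steps (List (Row A × K))
  | 0, _, _ => pure []
  | n + 1, u, p => do
    let R ← Q.select u
    let ms ← gather (fun i => do
      let out ← Q.absorb n i (some u)
      Q.emit n i u out) ((Q.inNbrs u p).sort (· ≤ ·))
    leapfrogTriejoin (R :: ms)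

/-- The message `u → v`.  A path in the tree has at most `Fintype.card V` bags. -/
def message (Q : Query V A K) (u v : V) : Steps (Table A K) := do
  let out ← Q.absorb (Fintype.card V) u (some v)
  Q.emit (Fintype.card V) u v out

/-- Upward message passing to the root `r`, absorption at `r`, and the final aggregation. -/
def messagePassing (Q : Query V A K) (r : V) : Steps (List (Row A × K)) := do
  let out ← Q.absorb (Fintype.card V) r none
  hashAggregate Q.groupBy [] out

/-! ### The quantities in the bounds -/

/-- The size `|R_u|` of the relation of `u`. -/
def size (Q : Query V A K) (u : V) : ℕ := (Q.rel u).length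

/-- The combined selectivity `s(u)` of the selections on `u`: the fraction of tuples selected. -/
noncomputable def selectivity (Q : Query V A K) (u : V) : ℝ :=
  (((Q.rel u).filter fun r => Q.sel u r.1).length : ℝ) / Q.size u

/-- A fractional edge cover: nonnegative weights of the relations such that the relations containing
an attribute have total weight at least one, for each attribute. -/
def IsFractionalEdgeCover (Q : Query V A K) (x : V → ℝ) : Prop :=
  (∀ v, 0 ≤ x v) ∧ ∀ a ∈ Q.attrs, 1 ≤ ∑ v ∈ Finset.univ.filter (fun v => a ∈ Q.bag v), x v

/-- The fractional edge cover bound `ρ` of the size of the join of the selected relations. -/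
noncomputable def edgeCoverBound (Q : Query V A K) : ℝ :=
  sInf {b | ∃ x : V → ℝ, Q.IsFractionalEdgeCover x ∧
    b = ∏ v, (Q.selectivity v * Q.size v) ^ (x v)}

/-- `max_v s(v)·|R_v|`. -/
noncomputable def maxSelected (Q : Query V A K) : ℝ :=
  Finset.univ.fold max 0 fun v => Q.selectivity v * Q.size v

/-- `g(u, v)`: the number of group-by attributes from bags upstream of `u → v` that are carried into
`u` by the messages and are not attributes of `u` itself. -/
def numCarried (Q : Query V A K) (u : V) (v : Option V) : ℕ :=
  (((Q.inNbrs u v).biUnion fun i => Q.carried (Fintype.card V) i (some u)) \ Q.bag u).card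

/-- The message size bound `S(u, v) = d^{g(u, v)} s(u) |R_u|`. -/
noncomputable def sizeBound (Q : Query V A K) (d : ℕ) (u : V) (v : Option V) : ℝ :=
  (d : ℝ) ^ Q.numCarried u v * (Q.selectivity u * Q.size u)

/-- The cost `M(u, v)` of passing the message `u → v`, or of the absorption at `u` if `v` is `none`:
`(|U(u, v)| + 1) (|u| + g(u, v)) S(u, v) log (1 + max (max_{x ∈ U(u, v)} S(x, u), s(u) |R_u|))`. -/
noncomputable def messageCost (Q : Query V A K) (d : ℕ) (u : V) (v : Option V) : ℝ :=
  (((Q.inNbrs u v).card : ℝ) + 1) * (((Q.bag u).card : ℝ) + Q.numCarried u v) *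
    Q.sizeBound d u v *
    Real.log (1 + (Q.inNbrs u v).fold max (Q.selectivity u * Q.size u)
      fun x => Q.sizeBound d x (some u))

/-- `Tra(r)`, the directed edges `u → v` towards the root `r`. -/
noncomputable def traversed (Q : Query V A K) (r : V) : Finset (V × V) :=
  Finset.univ.filter fun e => Q.tree.Adj e.1 e.2 ∧ Q.tree.dist e.1 r = Q.tree.dist e.2 r + 1

end Query

end SPJA

/-! ### Values and costs of composed programs. -/

namespace Steps

/-! One amortised analysis of the leapfrog triejoin gives all three bounds. Give each table a weight
x ≥ 0 and each attribute a weight y ≥ 0 such that, for every attribute a, the weights of the tables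
containing a, together with y(a), sum to at least 1. The potential of a node of the search is the
product of (block size)^x over the tables, times the product of |dom a|^y(a) over the attributes
still to be bound. Thus the domain of a acts as an extra unary table of weight y(a).

Two facts drive the analysis. By Hölder (`powProd_add_le`), the potentials of the nodes below a node
add up to at most its own potential (`leapfrog_bound`). The number of leapfrog rounds at a node is
at most three times the number of distinct values in its sparsest iterator, and this number is at
most the potential (`Ready.exists_card_le`). So every level of the search costs at most a constant
times the initial potential times the cost of a round, and the output has at most as many tuples as
the initial potential (`trieJoin_bound`). A round makes at most two binary searches per table, which
is where the logarithm comes from.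

For naive execution take y = 0 and let x run over the fractional edge covers; the infimum of the
potentials is ρ. For the join at a bag u give weight 1 to the relation of u, weight 0 to all
messages, and weight 1 to exactly the attributes outside u. The potential is then at most d^g
s(u)|R_u|, whatever the sizes of the incoming messages (`potential_le`). Aggregating and sorting
never lengthen a table, so this bounds the message size as well.

Hashing is linear in the join output. Sorting n tuples costs a factor log n, and n ≤ M^k for k
tables of size at most M, so log n is at most k log(1 + M), which the cost formula contains.

Finally, in the tree rooted at r every bag but r sends exactly one message, so the costs telescope
over the bags (`le_sum_of_le_add_children`). Since relations are nonempty, additive constants per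
bag or edge are absorbed by the sum of the |R_u|. -/

@[simp] theorem bind_val {α β : Type} (x : Steps α) (f : α → Steps β) :
    (x >>= f).val = (f x.val).val := rfl

@[simp] theorem bind_time {α β : Type} (x : Steps α) (f : α → Steps β) :
    (x >>= f).time = x.time + (f x.val).time := rfl

@[simp] theorem pure_val {α : Type} (a : α) : (pure a : Steps α).val = a := rfl

@[simp] theorem pure_time {α : Type} (a : α) : (pure a : Steps α).time = 0 := rfl

@[simp] theorem tick_time (n : ℕ) : (tick n).time = n := rfl

end Steps

namespace SPJA

open Steps

/-! ### Scanning, hashing and sorting -/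

theorem gather_val {V β : Type} (f : V → Steps β) (l : List V) :
    (gather f l).val = l.map fun v => (f v).val := by
  induction l with
  | nil => simp [gather]
  | cons v l ih => simp [gather, ih]

theorem gather_time {V β : Type} (f : V → Steps β) (l : List V) :
    (gather f l).time = (l.map fun v => (f v).time).sum + l.length + 1 := by
  induction l with
  | nil => simp [gather]
  | cons v l ih => simp [gather, ih]; omega

section Rows

variable {A K : Type}

theorem filterRows_val (P : Row A → Bool) (l : List (Row A × K)) :
    (filterRows P l).val = l.filter fun r => P r.1 := by
  induction l with
  | nil => simp [filterRows]
  | cons r l ih => simp [filterRows, ih, List.filter_cons]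

theorem filterRows_time (P : Row A → Bool) (l : List (Row A × K)) :
    (filterRows P l).time = l.length + 1 := by
  induction l with
  | nil => simp [filterRows]
  | cons r l ih => simp [filterRows, ih]; omega

variable [LinearOrder A]

/-- All values of the tuples at the attributes `S` belong to the domains. -/
def RowsIn (dom : A → Finset ℕ) (S : Finset A) (l : List (Row A × K)) : Prop :=
  ∀ r ∈ l, ∀ a ∈ S, r.1 a ∈ dom a

/-- The tuples are sorted lexicographically by the attributes `S`. -/
def RowsSorted (S : Finset A) (l : List (Row A × K)) : Prop :=
  l.Pairwise fun r r' => keyOf S r.1 ≤ keyOf S r'.1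

theorem mergeRows_spec (S : Finset A) (ps qs : List (Row A × K)) :
    (mergeRows S ps qs).time ≤ (S.card + 1) * (ps.length + qs.length) + 1 ∧
      (mergeRows S ps qs).val.Perm (ps ++ qs) ∧
      (RowsSorted S ps → RowsSorted S qs → RowsSorted S (mergeRows S ps qs).val) := by
  induction ps, qs using mergeRows.induct with
  | case1 qs =>
    refine ⟨?_, ?_, ?_⟩
    · simp [mergeRows]; nlinarith
    · simp [mergeRows]
    · simp [mergeRows]
  | case2 p ps =>
    refine ⟨?_, ?_, ?_⟩
    · simp [mergeRows]; nlinarith [Nat.zero_le (S.card * (ps.length + 1))]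
    · simp [mergeRows]
    · simp only [mergeRows, bind_val, pure_val]; tauto
  | case3 p ps q qs ih₁ ih₂ =>
    rw [mergeRows]
    by_cases h : keyOf S p.1 ≤ keyOf S q.1
    · obtain ⟨h1, h2, h3⟩ := ih₁
      refine ⟨?_, ?_, ?_⟩
      · simp only [bind_time, tick_time, List.length_cons] at h1 ⊢
        simp only [if_pos h, bind_time, pure_time]
        nlinarith
      · simp only [bind_val, if_pos h, pure_val]
        simpa using h2
      · intro hp hq
        simp only [bind_val, if_pos h, pure_val]
        have hp' := List.pairwise_cons.1 hp
        have hq' := List.pairwise_cons.1 hq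
        refine List.pairwise_cons.2 ⟨fun r hr => ?_, h3 hp'.2 hq⟩
        rcases List.mem_append.1 (h2.mem_iff.1 hr) with hr | hr
        · exact hp'.1 r hr
        · rcases List.mem_cons.1 hr with rfl | hr
          · exact h
          · exact le_trans h (hq'.1 r hr)
    · obtain ⟨h1, h2, h3⟩ := ih₂
      refine ⟨?_, ?_, ?_⟩
      · simp only [bind_time, tick_time, List.length_cons] at h1 ⊢
        simp only [if_neg h, bind_time, pure_time]
        nlinarith
      · simp only [bind_val, if_neg h, pure_val]
        exact (List.Perm.cons q h2).trans (List.perm_middle (l₁ := p :: ps)).symm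
      · intro hp hq
        simp only [bind_val, if_neg h, pure_val]
        have hp' := List.pairwise_cons.1 hp
        have hq' := List.pairwise_cons.1 hq
        have h' := le_of_lt (not_le.1 h)
        refine List.pairwise_cons.2 ⟨fun r hr => ?_, h3 hp hq'.2⟩
        rcases List.mem_append.1 (h2.mem_iff.1 hr) with hr | hr
        · rcases List.mem_cons.1 hr with rfl | hr
          · exact h'
          · exact le_trans h' (hp'.1 r hr)
        · exact hq'.1 r hr

/-- Halving the length lowers the depth `b` by one. In the factor `S.card + 4`, the merge uses
`S.card + 1` per tuple and the split uses 1. The remaining 2 pay for the leftover additive constants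
of the two recursive calls and the merge. -/
theorem sortRows_spec (S : Finset A) (l : List (Row A × K)) :
    (∀ b, l.length ≤ 2 ^ b → (sortRows S l).time ≤ (S.card + 4) * l.length * b + 1) ∧
      (sortRows S l).val.Perm l ∧ RowsSorted S (sortRows S l).val := by
  induction l using sortRows.induct with
  | case1 l h =>
    rw [sortRows, if_pos h]
    refine ⟨fun b _ => by simp, by simp, ?_⟩
    match l, h with
    | [], _ => simp [RowsSorted]
    | [r], _ => simp [RowsSorted]
  | case2 l h ih1 ih2 =>
    rw [sortRows, if_neg h]
    obtain ⟨a1, a2, a3⟩ := ih1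
    obtain ⟨b1, b2, b3⟩ := ih2
    obtain ⟨c1, c2, c3⟩ := mergeRows_spec S (sortRows S (l.take (l.length / 2))).val
      (sortRows S (l.drop (l.length / 2))).val
    refine ⟨fun b hb => ?_, ?_, c3 a3 b3⟩
    · obtain ⟨b, rfl⟩ : ∃ b', b = b' + 1 :=
        Nat.exists_eq_succ_of_ne_zero (by rintro rfl; simp at hb; omega)
      have l1 : (l.take (l.length / 2)).length = l.length / 2 := by simp; omega
      have l2 : (l.drop (l.length / 2)).length = l.length - l.length / 2 := by simp
      have hb' : l.length ≤ 2 * 2 ^ b := by rw [pow_succ] at hb; omega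
      have t1 := a1 b (by omega)
      have t2 := b1 b (by omega)
      rw [a2.length_eq, b2.length_eq, l1, l2] at c1
      rw [l1] at t1
      rw [l2] at t2
      simp only [bind_time, tick_time]
      generalize hx : l.length / 2 = x at *
      obtain ⟨y, hy⟩ : ∃ y, l.length = x + y := ⟨l.length - x, by omega⟩
      rw [hy] at c1 t2 ⊢
      rw [Nat.add_sub_cancel_left] at c1 t2
      have hxy : 2 ≤ x + y := by omega
      nlinarith
    · simp only [bind_val]
      refine c2.trans ?_
      have := a2.append b2
      rwa [List.take_append_drop] at this

variable [CommSemiring K]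

theorem hashInsert_length_le (S : Finset A) (r : Row A × K) (l : List (Row A × K)) :
    (hashInsert S r l).length ≤ l.length + 1 := by
  induction l with
  | nil => simp [hashInsert]
  | cons e l ih =>
    rw [hashInsert]
    split_ifs
    · simp
    · simpa using ih

theorem RowsIn.hashInsert {dom : A → Finset ℕ} {S : Finset A} {r : Row A × K}
    (hr : ∀ a ∈ S, r.1 a ∈ dom a) {l : List (Row A × K)} (hl : RowsIn dom S l) :
    RowsIn dom S (hashInsert S r l) := by
  induction l with
  | nil =>
    intro e he a ha
    simp only [SPJA.hashInsert, List.mem_singleton] at he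
    subst he
    simpa [ha] using hr a ha
  | cons e l ih =>
    have hl' : RowsIn dom S l := fun x hx => hl x (List.mem_cons_of_mem _ hx)
    rw [SPJA.hashInsert]
    split_ifs with h
    · intro x hx
      rcases List.mem_cons.1 hx with rfl | hx
      · exact hl e List.mem_cons_self
      · exact hl' x hx
    · intro x hx
      rcases List.mem_cons.1 hx with rfl | hx
      · exact hl x List.mem_cons_self
      · exact ih hl' x hx

theorem hashAggregate_time (S : Finset A) (t l : List (Row A × K)) :
    (hashAggregate S t l).time = (S.card + 1) * l.length + 1 := by
  induction l generalizing t with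
  | nil => simp [hashAggregate]
  | cons r l ih => simp [hashAggregate, ih]; ring

theorem hashAggregate_length_le (S : Finset A) (t l : List (Row A × K)) :
    (hashAggregate S t l).val.length ≤ t.length + l.length := by
  induction l generalizing t with
  | nil => simp [hashAggregate]
  | cons r l ih =>
    simp only [hashAggregate, bind_val, List.length_cons]
    have := ih (hashInsert S r t)
    have := hashInsert_length_le S r t
    omega

theorem RowsIn.hashAggregate {dom : A → Finset ℕ} {S : Finset A} {t l : List (Row A × K)}
    (ht : RowsIn dom S t) (hl : RowsIn dom S l) :
    RowsIn dom S (hashAggregate S t l).val := by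
  induction l generalizing t with
  | nil => simpa [SPJA.hashAggregate] using ht
  | cons r l ih =>
    simp only [SPJA.hashAggregate, bind_val]
    exact ih (ht.hashInsert (hl r List.mem_cons_self)) fun x hx => hl x (List.mem_cons_of_mem _ hx)

end Rows

/-! ### Binary search -/

/-- The strict bound is what halves cleanly: after a probe at most half the interval, rounded down,
remains, and `b = 0` forces it to be empty. -/
theorem lowerBound_time_le (key : ℕ → ℕ) (x lo hi b : ℕ) (h : hi - lo < 2 ^ b) :
    (lowerBound key x lo hi).time ≤ b + 1 := by
  induction lo, hi using lowerBound.induct key x generalizing b with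
  | case1 lo hi h1 ih1 ih2 =>
    rw [lowerBound, if_pos h1]
    obtain ⟨b, rfl⟩ : ∃ b', b = b' + 1 :=
      Nat.exists_eq_succ_of_ne_zero (by rintro rfl; simp at h; omega)
    have i1 := ih1 b (by rw [pow_succ] at h; omega)
    have i2 := ih2 b (by rw [pow_succ] at h; omega)
    simp only [bind_time, tick_time]
    split_ifs <;> omega
  | case2 lo hi h1 =>
    rw [lowerBound, if_neg h1]
    simp

theorem lowerBound_spec (key : ℕ → ℕ) (x lo hi : ℕ) (hle : lo ≤ hi)
    (hmono : ∀ i j, lo ≤ i → i ≤ j → j < hi → key i ≤ key j) :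
    lo ≤ (lowerBound key x lo hi).val ∧ (lowerBound key x lo hi).val ≤ hi ∧
      (∀ i, lo ≤ i → i < (lowerBound key x lo hi).val → key i < x) ∧
      ∀ i, (lowerBound key x lo hi).val ≤ i → i < hi → x ≤ key i := by
  induction lo, hi using lowerBound.induct key x with
  | case1 lo hi h1 ih1 ih2 =>
    rw [lowerBound, if_pos h1]
    simp only [bind_val]
    by_cases h2 : key ((lo + hi) / 2) < x
    · obtain ⟨a1, a2, a3, a4⟩ := ih1 (by omega) fun i j h₁ hij hj => hmono i j (by omega) hij hj
      rw [if_pos h2]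
      refine ⟨by omega, a2, fun i hi₁ hi₂ => ?_, a4⟩
      by_cases hc : i ≤ (lo + hi) / 2
      · exact lt_of_le_of_lt (hmono i _ hi₁ hc (by omega)) h2
      · exact a3 i (by omega) hi₂
    · obtain ⟨a1, a2, a3, a4⟩ := ih2 (by omega) fun i j h₁ hij hj => hmono i j h₁ hij (by omega)
      rw [if_neg h2]
      refine ⟨a1, by omega, a3, fun i hi₁ hi₂ => ?_⟩
      by_cases hc : i < (lo + hi) / 2
      · exact a4 i hi₁ hc
      · exact le_trans (not_lt.1 h2) (hmono _ i (by omega) (by omega) hi₂)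
  | case2 lo hi h1 =>
    rw [lowerBound, if_neg h1]
    simp only [bind_val, pure_val]
    exact ⟨le_rfl, hle, fun i _ _ => by omega, fun i _ _ => by omega⟩

end SPJA

namespace SPJA

open Steps

/-! ### Weighted products -/

/-- The product of the powers `n ^ x` of corresponding entries of two lists. -/
noncomputable def powProd (xs : List ℝ) (ns : List ℕ) : ℝ :=
  (List.zipWith (fun x n => (n : ℝ) ^ x) xs ns).prod

/-- The sum of the weights that are flagged. -/
noncomputable def flagSum (xs : List ℝ) (fs : List Bool) : ℝ :=
  (List.zipWith (fun x f => if f then x else 0) xs fs).sum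

@[simp] theorem powProd_nil_left (ns : List ℕ) : powProd [] ns = 1 := by simp [powProd]

@[simp] theorem powProd_nil_right (xs : List ℝ) : powProd xs [] = 1 := by simp [powProd]

@[simp] theorem powProd_cons (x : ℝ) (xs : List ℝ) (n : ℕ) (ns : List ℕ) :
    powProd (x :: xs) (n :: ns) = (n : ℝ) ^ x * powProd xs ns := by simp [powProd]

@[simp] theorem flagSum_nil_left (fs : List Bool) : flagSum [] fs = 0 := by simp [flagSum]

@[simp] theorem flagSum_nil_right (xs : List ℝ) : flagSum xs [] = 0 := by simp [flagSum]

@[simp] theorem flagSum_cons (x : ℝ) (xs : List ℝ) (f : Bool) (fs : List Bool) :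
    flagSum (x :: xs) (f :: fs) = (if f then x else 0) + flagSum xs fs := by simp [flagSum]

theorem powProd_nonneg (xs : List ℝ) (ns : List ℕ) : 0 ≤ powProd xs ns := by
  induction xs generalizing ns with
  | nil => simp
  | cons x xs ih =>
    cases ns with
    | nil => simp
    | cons n ns => rw [powProd_cons]; exact mul_nonneg (by positivity) (ih ns)

theorem one_le_powProd {xs : List ℝ} (hx : ∀ x ∈ xs, 0 ≤ x) {ns : List ℕ}
    (hn : ∀ n ∈ ns, 1 ≤ n) : 1 ≤ powProd xs ns := by
  induction xs generalizing ns with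
  | nil => simp
  | cons x xs ih =>
    cases ns with
    | nil => simp
    | cons n ns =>
      simp only [List.forall_mem_cons] at hx hn
      rw [powProd_cons]
      exact one_le_mul_of_one_le_of_one_le
        (Real.one_le_rpow (by exact_mod_cast hn.1) hx.1) (ih hx.2 hn.2)

theorem powProd_mono {xs : List ℝ} (hx : ∀ x ∈ xs, 0 ≤ x) {ns ms : List ℕ}
    (h : List.Forall₂ (· ≤ ·) ns ms) : powProd xs ns ≤ powProd xs ms := by
  induction h generalizing xs with
  | nil => simp
  | cons hnm _ ih =>
    cases xs with
    | nil => simp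
    | cons x xs =>
      simp only [List.forall_mem_cons] at hx
      rw [powProd_cons, powProd_cons]
      exact mul_le_mul (Real.rpow_le_rpow (by positivity) (by exact_mod_cast hnm) hx.1) (ih hx.2)
        (powProd_nonneg _ _) (by positivity)

/-- Hölder's inequality for two pairs of numbers. -/
theorem rpow_mul_rpow_add_le {P Q p q α β : ℝ} (hP : 0 ≤ P) (hQ : 0 ≤ Q) (hp : 0 ≤ p) (hq : 0 ≤ q)
    (hα : 0 ≤ α) (hβ : 0 ≤ β) (h : α + β = 1) :
    P ^ α * p ^ β + Q ^ α * q ^ β ≤ (P + Q) ^ α * (p + q) ^ β := by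
  -- Zero exponents and zero totals are removed first, because the main argument divides by both
  -- totals.
  rcases hα.eq_or_lt with rfl | hα'
  · have : β = 1 := by linarith
    simp [this]
  rcases hβ.eq_or_lt with rfl | hβ'
  · have : α = 1 := by linarith
    simp [this]
  rcases (add_nonneg hP hQ).eq_or_lt with h0 | hT
  · have h1 : P = 0 := by linarith
    have h2 : Q = 0 := by linarith
    simp [h1, h2, Real.zero_rpow hα'.ne']
  rcases (add_nonneg hp hq).eq_or_lt with h0 | ht
  · have h1 : p = 0 := by linarith
    have h2 : q = 0 := by linarith
    simp [h1, h2, Real.zero_rpow hβ'.ne']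
  -- Weighted AM–GM for the shares of X and y in the two totals. Summed over both pairs, the shares
  -- add up to 1.
  have key : ∀ X y : ℝ, 0 ≤ X → 0 ≤ y →
      X ^ α * y ^ β ≤ (P + Q) ^ α * (p + q) ^ β * (α * (X / (P + Q)) + β * (y / (p + q))) := by
    intro X y hX hy
    have := Real.geom_mean_le_arith_mean2_weighted hα hβ (div_nonneg hX hT.le)
      (div_nonneg hy ht.le) h
    rw [Real.div_rpow hX hT.le, Real.div_rpow hy ht.le] at this
    have hA : 0 < (P + Q) ^ α := Real.rpow_pos_of_pos hT _
    have hB : 0 < (p + q) ^ β := Real.rpow_pos_of_pos ht _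
    calc X ^ α * y ^ β = (P + Q) ^ α * (p + q) ^ β *
          (X ^ α / (P + Q) ^ α * (y ^ β / (p + q) ^ β)) := by field_simp
      _ ≤ _ := by gcongr
  calc _ ≤ _ := add_le_add (key P p hP hp) (key Q q hQ hq)
    _ = (P + Q) ^ α * (p + q) ^ β *
        (α * ((P + Q) / (P + Q)) + β * ((p + q) / (p + q))) := by ring
    _ = _ := by rw [div_self hT.ne', div_self ht.ne', mul_one, mul_one, h, mul_one]

/-- Hölder's inequality for splitting the flagged entries of a weighted product. -/
theorem powProd_add_le {xs : List ℝ} (hx : ∀ x ∈ xs, 0 ≤ x) (l : List (Bool × ℕ × ℕ))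
    (hl : ∀ t ∈ l, t.1 = false → t.2.1 = t.2.2) {P Q T w : ℝ} (hP : 0 ≤ P) (hQ : 0 ≤ Q)
    (hT : P + Q ≤ T) (hw : 0 ≤ w) (h : 1 ≤ flagSum xs (l.map Prod.fst) + w) :
    P ^ w * powProd xs (l.map fun t => t.2.1) + Q ^ w * powProd xs (l.map fun t => t.2.2) ≤
      T ^ w * powProd xs (l.map fun t => if t.1 then t.2.1 + t.2.2 else t.2.1) := by
  -- Once all entries are absorbed, the accumulated exponent is at least 1 and superadditivity of t
  -- ↦ t^w finishes. This fact depends on the accumulators, so it is carried through the induction.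
  have base : 1 ≤ w → P ^ w + Q ^ w ≤ T ^ w := fun hw1 =>
    (Real.add_rpow_le_rpow_add hP hQ hw1).trans (Real.rpow_le_rpow (by positivity) hT hw)
  induction xs generalizing l P Q T w with
  | nil => simpa using base (by simpa using h)
  | cons x xs ih =>
    cases l with
    | nil => simpa using base (by simpa using h)
    | cons t l =>
      obtain ⟨f, p, q⟩ := t
      simp only [List.forall_mem_cons] at hx hl
      simp only [List.map_cons, powProd_cons, flagSum_cons] at h ⊢
      cases f with
      | false =>
        have hpq : p = q := hl.1 rfl
        subst hpq
        have := ih hx.2 l hl.2 hP hQ hT hw (by simpa using h) base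
        simp only [Bool.false_eq_true, if_false]
        have hp : (0 : ℝ) ≤ (p : ℝ) ^ x := by positivity
        calc _ = (p : ℝ) ^ x * (P ^ w * powProd xs (l.map fun t => t.2.1) +
              Q ^ w * powProd xs (l.map fun t => t.2.2)) := by ring
          _ ≤ _ := mul_le_mul_of_nonneg_left this hp
          _ = _ := by ring
      | true =>
        simp only [if_true] at h ⊢
        have hT0 : 0 ≤ T := by linarith
        rcases (add_nonneg hw hx.1).eq_or_lt with h0 | hs
        · have h1 : w = 0 := by linarith [hx.1]
          have h2 : x = 0 := by linarith
          subst h1 h2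
          have := ih hx.2 l hl.2 hP hQ hT le_rfl (by linarith) base
          simpa using this
        -- The accumulator (exponent w) and the head entry (exponent x) are fused into one
        -- accumulator of exponent s by two-term Hölder with weights w/s and x/s. Only an inequality
        -- for the new total survives, hence the separate `T`.
        · set s := w + x with hs'
          have hp : (0 : ℝ) ≤ p := by positivity
          have hq : (0 : ℝ) ≤ q := by positivity
          have split : ∀ X y : ℝ, 0 ≤ X → 0 ≤ y →
              (X ^ (w / s) * y ^ (x / s)) ^ s = X ^ w * y ^ x := by
            intro X y hX hy
            rw [Real.mul_rpow (by positivity) (by positivity), ← Real.rpow_mul hX,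
              ← Real.rpow_mul hy, div_mul_cancel₀ _ hs.ne', div_mul_cancel₀ _ hs.ne']
          have hsum : P ^ (w / s) * (p : ℝ) ^ (x / s) + Q ^ (w / s) * (q : ℝ) ^ (x / s) ≤
              T ^ (w / s) * ((p : ℝ) + q) ^ (x / s) := by
            refine (rpow_mul_rpow_add_le hP hQ hp hq (div_nonneg hw hs.le)
              (div_nonneg hx.1 hs.le) ?_).trans ?_
            · rw [← add_div, div_self hs.ne']
            · gcongr
          have hP' : 0 ≤ P ^ (w / s) * (p : ℝ) ^ (x / s) := by positivity
          have hQ' : 0 ≤ Q ^ (w / s) * (q : ℝ) ^ (x / s) := by positivity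
          have := ih hx.2 l hl.2 hP' hQ' hsum hs.le (by linarith) fun hs1 =>
            (Real.add_rpow_le_rpow_add hP' hQ' hs1).trans
              (Real.rpow_le_rpow (by positivity) hsum hs.le)
          rw [split P p hP hp, split Q q hQ hq, split T _ hT0 (by positivity)] at this
          push_cast
          simpa only [mul_assoc] using this

/-- If all flagged entries are at least `μ` and the others at least one, then so is the weighted
product, up to the power of `μ` by the flagged weights. -/
theorem rpow_flagSum_le_powProd {xs : List ℝ} (hx : ∀ x ∈ xs, 0 ≤ x) {μ : ℕ} (hμ : 1 ≤ μ)
    (l : List (Bool × ℕ)) (hlen : xs.length = l.length)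
    (hl : ∀ t ∈ l, 1 ≤ t.2 ∧ (t.1 = true → μ ≤ t.2)) :
    (μ : ℝ) ^ flagSum xs (l.map Prod.fst) ≤ powProd xs (l.map Prod.snd) := by
  have hμ' : (0 : ℝ) < μ := by exact_mod_cast hμ
  induction xs generalizing l with
  | nil => simp
  | cons x xs ih =>
    cases l with
    | nil => simp at hlen
    | cons t l =>
      obtain ⟨f, n⟩ := t
      simp only [List.forall_mem_cons] at hx hl
      have := ih hx.2 l (by simpa using hlen) hl.2
      simp only [List.map_cons, powProd_cons, flagSum_cons]
      rw [Real.rpow_add hμ']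
      refine mul_le_mul ?_ this (by positivity) (by positivity)
      cases f with
      | false => simpa using Real.one_le_rpow (by exact_mod_cast hl.1.1) hx.1
      | true =>
        simpa using Real.rpow_le_rpow hμ'.le (by exact_mod_cast hl.1.2 rfl) hx.1

/-! ### One level of the leapfrog join -/

theorem cons_le_cons_iff_lt_or_eq {a b : ℕ} {l m : List ℕ} :
    a :: l ≤ b :: m ↔ a < b ∨ a = b ∧ l ≤ m := by
  rw [← not_lt, List.cons_lt_cons_iff, ← not_lt (a := m)]
  rcases lt_trichotomy a b with h | h | h
  · simp [h, h.not_gt, h.ne']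
  · simp [h]
  · simp [h, h.not_gt, h.ne']

/-- The number of tuples in the block of an iterator. -/
def Cursor.size {A K : Type} (c : Cursor A K) : ℕ := c.hi - c.pos

section Leapfrog

variable {A K : Type} [LinearOrder A]

/-- The block of an iterator is sorted by the attributes in `L`, and its values are in the
domains. -/
structure Cursor.Ok (dom : A → Finset ℕ) (L : List A) (c : Cursor A K) : Prop where
  le : c.pos ≤ c.hi
  sorted : ∀ i j, c.pos ≤ i → i ≤ j → j < c.hi →
    (L.filter (· ∈ c.table.attrs)).map (fun a => c.table.cell a i) ≤
      (L.filter (· ∈ c.table.attrs)).map (fun a => c.table.cell a j)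
  mem_dom : ∀ i, c.pos ≤ i → i < c.hi → ∀ a ∈ c.table.attrs, c.table.cell a i ∈ dom a

variable {dom : A → Finset ℕ}

theorem Cursor.Ok.cell_mono {a : A} {as : List A} {c : Cursor A K} (h : c.Ok dom (a :: as))
    (ha : a ∈ c.table.attrs) (i j : ℕ) (hi : c.pos ≤ i) (hij : i ≤ j) (hj : j < c.hi) :
    c.table.cell a i ≤ c.table.cell a j := by
  have := h.sorted i j hi hij hj
  rw [List.filter_cons_of_pos (by simpa using ha), List.map_cons, List.map_cons,
    cons_le_cons_iff_lt_or_eq] at this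
  rcases this with h | h
  · exact h.le
  · exact h.1.le

theorem Cursor.Ok.tail {a : A} {as : List A} {c : Cursor A K} (h : c.Ok dom (a :: as))
    (ha : a ∉ c.table.attrs) : c.Ok dom as := by
  refine ⟨h.le, fun i j hi hij hj => ?_, h.mem_dom⟩
  have := h.sorted i j hi hij hj
  rwa [List.filter_cons_of_neg (by simpa using ha)] at this

/-- A subblock of a sorted block is sorted. -/
theorem Cursor.Ok.sub {L : List A} {c c' : Cursor A K} (h : c.Ok dom L)
    (ht : c'.table = c.table) (hp : c.pos ≤ c'.pos) (hle : c'.pos ≤ c'.hi) (hh : c'.hi ≤ c.hi) :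
    c'.Ok dom L := by
  refine ⟨hle, fun i j hi hij hj => ?_, fun i hi hi' => ?_⟩
  · rw [ht]; exact h.sorted i j (hp.trans hi) hij (hj.trans_le hh)
  · rw [ht]; exact h.mem_dom i (hp.trans hi) (hi'.trans_le hh)

/-- When the leading component is constant, lexicographic order is decided by the others. This makes
an opened block a valid trie node one level down. -/
theorem Cursor.Ok.tail_of_const {a : A} {as : List A} {c : Cursor A K} (h : c.Ok dom (a :: as))
    (ha : a ∈ c.table.attrs) {x : ℕ} (hx : ∀ i, c.pos ≤ i → i < c.hi → c.table.cell a i = x) :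
    c.Ok dom as := by
  refine ⟨h.le, fun i j hi hij hj => ?_, h.mem_dom⟩
  have := h.sorted i j hi hij hj
  rw [List.filter_cons_of_pos (by simpa using ha), List.map_cons, List.map_cons,
    cons_le_cons_iff_lt_or_eq, hx i hi (by omega), hx j (by omega) hj] at this
  rcases this with h | h
  · exact absurd h (lt_irrefl _)
  · exact h.2

/-- The iterator `c'` arises from `c` by seeking a value between `x` and `y` of the attribute `a`. -/
structure Advanced (a : A) (x y : ℕ) (c c' : Cursor A K) : Prop where
  table : c'.table = c.table
  hi : c'.hi = c.hi
  pos : c.pos ≤ c'.pos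
  le : c'.pos ≤ c'.hi
  mem : a ∈ c.table.attrs →
    c'.pos < c'.hi ∧ x ≤ c.table.cell a c'.pos ∧ c.table.cell a c'.pos ≤ y
  notMem : a ∉ c.table.attrs → c' = c

theorem leapfrogRound_time_le (a : A) (b x : ℕ) (cs : List (Cursor A K))
    (hb : ∀ c ∈ cs, c.size < 2 ^ b) :
    (leapfrogRound a x cs).time ≤ cs.length * (b + 2) + 1 := by
  induction cs generalizing x with
  | nil => simp [leapfrogRound]
  | cons c cs ih =>
    simp only [List.forall_mem_cons] at hb
    rw [leapfrogRound]
    simp only [bind_time, tick_time, List.length_cons]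
    rw [add_mul, one_mul]
    split_ifs with h1
    · have t1 := lowerBound_time_le (c.table.cell a) x c.pos c.hi b hb.1
      simp only [bind_time]
      split_ifs with h2
      · have := ih (c.table.cell a (lowerBound (c.table.cell a) x c.pos c.hi).val) hb.2
        simp only [bind_time, pure_time]
        omega
      · simp only [pure_time]
        omega
    · have := ih x hb.2
      simp only [bind_time, pure_time]
      omega

/-- The sought value only grows along the list, so every iterator over `a` ends between the initial
`x` and the final `y`. In particular, `y = x` means that they all agree. -/
theorem leapfrogRound_spec (a : A) (as : List A) (x : ℕ) (cs : List (Cursor A K))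
    (hok : ∀ c ∈ cs, c.Ok dom (a :: as)) {y : ℕ} {cs' : List (Cursor A K)}
    (h : (leapfrogRound a x cs).val = some (y, cs')) :
    x ≤ y ∧ List.Forall₂ (Advanced a x y) cs cs' := by
  induction cs generalizing x cs' with
  | nil =>
    simp only [leapfrogRound, bind_val, pure_val, Option.some.injEq, Prod.mk.injEq] at h
    obtain ⟨rfl, rfl⟩ := h
    exact ⟨le_rfl, List.Forall₂.nil⟩
  | cons c cs ih =>
    simp only [List.forall_mem_cons] at hok
    rw [leapfrogRound] at h
    simp only [bind_val] at h
    split_ifs at h with h1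
    · obtain ⟨a1, a2, a3, a4⟩ := lowerBound_spec (c.table.cell a) x c.pos c.hi hok.1.le
        (hok.1.cell_mono h1)
      simp only [bind_val] at h
      split_ifs at h with h2
      · simp only [bind_val, pure_val, Option.map_eq_some_iff] at h
        obtain ⟨⟨y', cs''⟩, h3, h4⟩ := h
        simp only [Prod.mk.injEq] at h4
        obtain ⟨rfl, rfl⟩ := h4
        obtain ⟨b1, b2⟩ := ih _ hok.2 h3
        have hx := a4 _ le_rfl h2
        refine ⟨hx.trans b1, List.Forall₂.cons ⟨rfl, rfl, a1, a2, fun _ => ⟨h2, hx, b1⟩,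
          fun h => absurd h1 h⟩ (b2.imp fun c c' hc => ?_)⟩
        exact ⟨hc.table, hc.hi, hc.pos, hc.le,
          fun h => ⟨(hc.mem h).1, hx.trans (hc.mem h).2.1, (hc.mem h).2.2⟩, hc.notMem⟩
    · simp only [bind_val, pure_val, Option.map_eq_some_iff] at h
      obtain ⟨⟨y', cs''⟩, h3, h4⟩ := h
      simp only [Prod.mk.injEq] at h4
      obtain ⟨rfl, rfl⟩ := h4
      obtain ⟨b1, b2⟩ := ih _ hok.2 h3
      exact ⟨b1, List.Forall₂.cons ⟨rfl, rfl, le_rfl, hok.1.le, fun h => absurd h h1,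
        fun _ => rfl⟩ b2⟩

theorem openBlocks_time_le (a : A) (b x : ℕ) (cs : List (Cursor A K))
    (hb : ∀ c ∈ cs, c.size < 2 ^ b) :
    (openBlocks a x cs).time ≤ cs.length * (b + 2) + 1 := by
  induction cs with
  | nil => simp [openBlocks]
  | cons c cs ih =>
    simp only [List.forall_mem_cons] at hb
    have := ih hb.2
    rw [openBlocks]
    simp only [bind_time, tick_time, List.length_cons]
    rw [add_mul, one_mul]
    split_ifs with h1
    · have t1 := lowerBound_time_le (c.table.cell a) (x + 1) c.pos c.hi b hb.1
      simp only [bind_time, pure_time]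
      omega
    · simp only [bind_time, pure_time]
      omega

/-- The pair `b` consists of the block of the value `x` in `c` and of the rest of `c`. -/
structure Splits (a : A) (x : ℕ) (c : Cursor A K) (b : Cursor A K × Cursor A K) : Prop where
  fst_table : b.1.table = c.table
  snd_table : b.2.table = c.table
  fst_pos : b.1.pos = c.pos
  snd_hi : b.2.hi = c.hi
  mem : a ∈ c.table.attrs → b.1.pos < b.1.hi ∧ b.1.hi = b.2.pos ∧ b.2.pos ≤ b.2.hi ∧
    ∀ i, b.1.pos ≤ i → i < b.1.hi → c.table.cell a i = x
  notMem : a ∉ c.table.attrs → b = (c, c)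

theorem openBlocks_spec (a : A) (as : List A) (x : ℕ) (cs : List (Cursor A K))
    (hok : ∀ c ∈ cs, c.Ok dom (a :: as))
    (hx : ∀ c ∈ cs, a ∈ c.table.attrs → c.pos < c.hi ∧ c.table.cell a c.pos = x) :
    List.Forall₂ (Splits a x) cs (openBlocks a x cs).val := by
  induction cs with
  | nil => simp [openBlocks]
  | cons c cs ih =>
    simp only [List.forall_mem_cons] at hok hx
    have := ih hok.2 hx.2
    rw [openBlocks]
    simp only [bind_val]
    split_ifs with h1
    · obtain ⟨a1, a2, a3, a4⟩ := lowerBound_spec (c.table.cell a) (x + 1) c.pos c.hi hok.1.le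
        (hok.1.cell_mono h1)
      obtain ⟨b1, b2⟩ := hx.1 h1
      simp only [bind_val, pure_val]
      refine List.Forall₂.cons ⟨rfl, rfl, rfl, rfl, fun _ => ⟨?_, rfl, a2, fun i hi hi' => ?_⟩,
        fun h => absurd h1 h⟩ this
      · by_contra hc
        have := a4 c.pos (not_lt.1 hc) b1
        omega
      · have c1 := a3 i hi hi'
        have c2 := hok.1.cell_mono h1 c.pos i le_rfl hi (hi'.trans_le a2)
        omega
    · simp only [bind_val, pure_val]
      exact List.Forall₂.cons ⟨rfl, rfl, rfl, rfl, fun h => absurd h h1, fun _ => rfl⟩ this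

/-- A bound for the number of rounds of a leapfrog join from the value `x` on, if one of the
iterators runs through the values `vals`. -/
def rounds (vals : Finset ℕ) (x : ℕ) : ℕ :=
  2 * (vals.filter (x ≤ ·)).card + if x ∈ vals then 0 else 1

/-- Each value pays for two rounds, and the extra unit when `x ∉ vals` pays for a first seek that
loses no value. Here `z` is where the counted iterator lands: if `z < y`, then `z` is left behind
for good; if `z = y` and `x ∉ vals`, the extra unit disappears because `y ∈ vals`. -/
theorem rounds_succ_le {vals : Finset ℕ} {x y z : ℕ} (hz : z ∈ vals) (hxz : x ≤ z)
    (hzy : z ≤ y) (hxy : x < y) : rounds vals y + 1 ≤ rounds vals x := by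
  have hsub : vals.filter (y ≤ ·) ⊆ vals.filter (x ≤ ·) := fun v hv => by
    simp only [Finset.mem_filter] at hv ⊢
    exact ⟨hv.1, by omega⟩
  have hlt : ∀ v ∈ vals, x ≤ v → v < y →
      (vals.filter (y ≤ ·)).card + 1 ≤ (vals.filter (x ≤ ·)).card := fun v hv h1 h2 =>
    Finset.card_lt_card ⟨hsub, fun h => by
      have := h (Finset.mem_filter.2 ⟨hv, h1⟩)
      simp only [Finset.mem_filter] at this
      omega⟩
  unfold rounds
  by_cases hx : x ∈ vals
  · have := hlt x hx le_rfl hxy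
    split_ifs <;> omega
  · rw [if_neg hx]
    by_cases hzy' : z < y
    · have := hlt z hz hxz hzy'
      split_ifs <;> omega
    · have : z = y := by omega
      have hy : y ∈ vals := this ▸ hz
      have := Finset.card_le_card hsub
      rw [if_pos hy]
      omega

theorem one_le_rounds {vals : Finset ℕ} (x : ℕ) : 1 ≤ rounds vals x := by
  unfold rounds
  split_ifs with h
  · have : 0 < (vals.filter (x ≤ ·)).card := Finset.card_pos.2 ⟨x, by simp [h]⟩
    omega
  · omega

end Leapfrog

end SPJA

namespace SPJA

open Steps

/-! ### Amortised cost of one trie level. -/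

section Join

theorem exists_of_forall₂_right {α β : Type} {R : α → β → Prop} {l : List α} {m : List β}
    (h : List.Forall₂ R l m) {b : β} (hb : b ∈ m) : ∃ a ∈ l, R a b := by
  induction h with
  | nil => simp at hb
  | cons hab _ ih =>
    rcases List.mem_cons.1 hb with rfl | hb
    · exact ⟨_, List.mem_cons_self, hab⟩
    · obtain ⟨a, ha, h⟩ := ih hb
      exact ⟨a, List.mem_cons_of_mem _ ha, h⟩

theorem exists_of_forall₂_left {α β : Type} {R : α → β → Prop} {l : List α} {m : List β}
    (h : List.Forall₂ R l m) {a : α} (ha : a ∈ l) : ∃ b ∈ m, R a b :=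
  exists_of_forall₂_right (R := flip R) h.flip ha

theorem map_eq_map_of_forall₂ {α β γ : Type} {R : α → β → Prop} {f : α → γ} {g : β → γ}
    (hfg : ∀ a b, R a b → f a = g b) {l : List α} {m : List β} (h : List.Forall₂ R l m) :
    l.map f = m.map g := by
  induction h with
  | nil => rfl
  | cons hab _ ih => simp [hfg _ _ hab, ih]

variable {A K : Type}

/-- The product of the weighted sizes of the domains of the attributes in a list. -/
noncomputable def domProd (dom : A → Finset ℕ) (y : A → ℝ) (L : List A) : ℝ :=
  (L.map fun a => ((dom a).card : ℝ) ^ y a).prod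

theorem domProd_cons (dom : A → Finset ℕ) (y : A → ℝ) (a : A) (L : List A) :
    domProd dom y (a :: L) = ((dom a).card : ℝ) ^ y a * domProd dom y L := by
  simp [domProd]

theorem domProd_nonneg (dom : A → Finset ℕ) (y : A → ℝ) (L : List A) : 0 ≤ domProd dom y L := by
  induction L with
  | nil => simp [domProd]
  | cons a L ih => rw [domProd_cons]; exact mul_nonneg (by positivity) ih

theorem one_le_domProd {dom : A → Finset ℕ} {y : A → ℝ} (hy : ∀ a, 0 ≤ y a) {L : List A}
    (hL : ∀ a ∈ L, (dom a).Nonempty) : 1 ≤ domProd dom y L := by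
  induction L with
  | nil => simp [domProd]
  | cons a L ih =>
    simp only [List.forall_mem_cons] at hL
    rw [domProd_cons]
    exact one_le_mul_of_one_le_of_one_le
      (Real.one_le_rpow (by exact_mod_cast hL.1.card_pos) (hy a)) (ih hL.2)

variable [LinearOrder A]

/-- Flags for the tables that have the attribute `a`. -/
def flags (a : A) (ts : List (Table A K)) : List Bool := ts.map fun T => decide (a ∈ T.attrs)

/-- Valid states of the iterators, before the attributes in `L` are bound: their tables are `ts`, and
their blocks are nonempty, of size less than `2 ^ b`, and sorted by the attributes in `L`. -/
structure Ready (dom : A → Finset ℕ) (ts : List (Table A K)) (b : ℕ) (L : List A)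
    (cs : List (Cursor A K)) : Prop where
  table : cs.map Cursor.table = ts
  ok : ∀ c ∈ cs, c.Ok dom L
  pos : ∀ c ∈ cs, c.pos < c.hi
  size : ∀ c ∈ cs, c.size < 2 ^ b

/-- A bound for the number of steps of one round of a leapfrog join of `k` tables. -/
def roundCost (k b : ℕ) : ℕ := 2 * k * (b + 2) + 3

variable {dom : A → Finset ℕ} {ts : List (Table A K)} {b : ℕ} {xs : List ℝ} {y : A → ℝ}

/-- Hölder splits the potential of a node between the block of the current value and the unvisited
rest, so the calls of `body` together are charged at most the whole potential. The remaining work is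
`roundCost` per round, counted by `rounds` along any single iterator over `a`. Stopping early when
`n` runs out can only reduce cost and output, so no lower bound on `n` is needed. Iterators over `a`
may be empty on entry, since opening the last block leaves an empty rest. -/
theorem leapfrog_bound (hxs : ∀ x ∈ xs, 0 ≤ x) (hy : ∀ a, 0 ≤ y a) {a : A} {as : List A}
    (hcov : 1 ≤ flagSum xs (flags a ts) + y a)
    {body : ℕ → List (Cursor A K) → Steps (List (Row A × K))} {τ : ℝ} (hτ : 0 ≤ τ)
    {P : Row A × K → Prop}
    (hbody : ∀ x ∈ dom a, ∀ cs, Ready dom ts b as cs →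
      ((body x cs).time : ℝ) ≤ τ * (domProd dom y as * powProd xs (cs.map Cursor.size)) ∧
      ((body x cs).val.length : ℝ) ≤ domProd dom y as * powProd xs (cs.map Cursor.size) ∧
      ∀ r ∈ (body x cs).val, P r)
    (vals : Finset ℕ) (n x : ℕ) (cs : List (Cursor A K))
    (hts : cs.map Cursor.table = ts) (hok : ∀ c ∈ cs, c.Ok dom (a :: as))
    (hpos : ∀ c ∈ cs, a ∉ c.table.attrs → c.pos < c.hi) (hsize : ∀ c ∈ cs, c.size < 2 ^ b)
    (hvals : ∃ c ∈ cs, a ∈ c.table.attrs ∧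
      ∀ i, c.pos ≤ i → i < c.hi → c.table.cell a i ∈ vals) :
    ((leapfrog a body n x cs).time : ℝ) ≤ roundCost ts.length b * rounds vals x +
        τ * ((((dom a).filter (x ≤ ·)).card : ℝ) ^ y a *
          (domProd dom y as * powProd xs (cs.map Cursor.size))) ∧
      ((leapfrog a body n x cs).val.length : ℝ) ≤
        (((dom a).filter (x ≤ ·)).card : ℝ) ^ y a *
          (domProd dom y as * powProd xs (cs.map Cursor.size)) ∧
      ∀ r ∈ (leapfrog a body n x cs).val, P r := by
  induction n generalizing x cs with
  | zero =>
    have h1 := domProd_nonneg dom y as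
    have h2 := powProd_nonneg xs (cs.map Cursor.size)
    simp only [leapfrog, pure_time, pure_val, List.length_nil, Nat.cast_zero]
    exact ⟨by positivity, by positivity, by simp⟩
  | succ n ih =>
    have hD := domProd_nonneg dom y as
    have hW := powProd_nonneg xs (cs.map Cursor.size)
    have hlen : cs.length = ts.length := by rw [← hts, List.length_map]
    have t1 := leapfrogRound_time_le a b x cs hsize
    have s1 := fun z cs' => leapfrogRound_spec (y := z) (cs' := cs') a as x cs hok
    rw [leapfrog]
    simp only [bind_time, bind_val, tick_time]
    rw [hlen] at t1
    have hr1 : (1 : ℝ) ≤ rounds vals x := by exact_mod_cast one_le_rounds x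
    cases hres : (leapfrogRound a x cs).val with
    | none =>
      simp only [pure_time, pure_val, List.length_nil, Nat.cast_zero]
      refine ⟨?_, by positivity, by simp⟩
      have h1 : ((1 + ((leapfrogRound a x cs).time + 0) : ℕ) : ℝ) ≤ roundCost ts.length b := by
        norm_cast
        unfold roundCost
        nlinarith [Nat.zero_le (ts.length * (b + 2))]
      have h2 : (roundCost ts.length b : ℝ) ≤ roundCost ts.length b * rounds vals x :=
        le_mul_of_one_le_right (by positivity) hr1
      have h3 : 0 ≤ τ * ((((dom a).filter (x ≤ ·)).card : ℝ) ^ y a *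
          (domProd dom y as * powProd xs (cs.map Cursor.size))) := by positivity
      linarith
    | some p =>
      obtain ⟨z, cs'⟩ := p
      obtain ⟨hxz, hadv⟩ := s1 z cs' hres
      have hts' : cs'.map Cursor.table = ts :=
        (map_eq_map_of_forall₂ (fun c c' h => h.table.symm) hadv).symm.trans hts
      have hok' : ∀ c ∈ cs', c.Ok dom (a :: as) := fun c' hc' => by
        obtain ⟨c, hc, h⟩ := exists_of_forall₂_right hadv hc'
        exact (hok c hc).sub h.table h.pos h.le h.hi.le
      have hpos' : ∀ c ∈ cs', c.pos < c.hi := fun c' hc' => by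
        obtain ⟨c, hc, h⟩ := exists_of_forall₂_right hadv hc'
        by_cases ha : a ∈ c.table.attrs
        · exact (h.mem ha).1
        · rw [h.notMem ha]
          exact hpos c hc ha
      have hsize' : ∀ c ∈ cs', c.size < 2 ^ b := fun c' hc' => by
        obtain ⟨c, hc, h⟩ := exists_of_forall₂_right hadv hc'
        have := hsize c hc
        have := h.pos
        have := h.hi
        unfold Cursor.size at *
        omega
      have hcell : ∀ c ∈ cs', a ∈ c.table.attrs →
          x ≤ c.table.cell a c.pos ∧ c.table.cell a c.pos ≤ z := fun c' hc' ha => by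
        obtain ⟨c, hc, h⟩ := exists_of_forall₂_right hadv hc'
        rw [h.table] at ha ⊢
        exact (h.mem ha).2
      have hvals' : ∃ c ∈ cs', a ∈ c.table.attrs ∧
          ∀ i, c.pos ≤ i → i < c.hi → c.table.cell a i ∈ vals := by
        obtain ⟨c, hc, ha, hv⟩ := hvals
        obtain ⟨c', hc', h⟩ := exists_of_forall₂_left hadv hc
        refine ⟨c', hc', by rwa [h.table], fun i hi hi' => ?_⟩
        rw [h.table]
        exact hv i (h.pos.trans hi) (by rw [← h.hi]; exact hi')
      have hmono : powProd xs (cs'.map Cursor.size) ≤ powProd xs (cs.map Cursor.size) := by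
        refine powProd_mono hxs (List.forall₂_map_left_iff.2 (List.forall₂_map_right_iff.2
          (hadv.flip.imp fun c' c h => ?_)))
        have := Advanced.pos h
        have := Advanced.hi h
        unfold Cursor.size
        omega
      -- The counted iterator now stands at one of its values, between `x` and `z`; this is the
      -- witness needed to decrease `rounds`.
      obtain ⟨c₀, hc₀, ha₀, hv₀⟩ := hvals'
      have hz₀ := hv₀ _ le_rfl (hpos' c₀ hc₀)
      obtain ⟨hxz₀, hzz₀⟩ := hcell c₀ hc₀ ha₀
      by_cases hzx : z = x
      · subst hzx
        simp only [if_true, bind_time, bind_val, pure_time, pure_val]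
        have t2 := openBlocks_time_le a b z cs' hsize'
        have hlen' : cs'.length = ts.length := by rw [← hts', List.length_map]
        rw [hlen'] at t2
        have s2 := openBlocks_spec a as z cs' hok' fun c hc ha =>
          ⟨hpos' c hc, le_antisymm (hcell c hc ha).2 (hcell c hc ha).1⟩
        generalize hbs : (openBlocks a z cs').val = bs at s2 ⊢
        have hz : z ∈ dom a := by
          have := (hok' c₀ hc₀).mem_dom _ le_rfl (hpos' c₀ hc₀) a ha₀
          rwa [le_antisymm hzz₀ hxz₀] at this
        have hzv : z ∈ vals := by rwa [le_antisymm hzz₀ hxz₀] at hz₀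
        have ts1 : (bs.map Prod.fst).map Cursor.table = ts := by
          rw [← hts', List.map_map]
          exact (map_eq_map_of_forall₂ (fun c c' h => h.fst_table.symm) s2).symm
        have ts2 : (bs.map Prod.snd).map Cursor.table = ts := by
          rw [← hts', List.map_map]
          exact (map_eq_map_of_forall₂ (fun c c' h => h.snd_table.symm) s2).symm
        have hready : Ready dom ts b as (bs.map Prod.fst) := by
          refine ⟨ts1, fun c hc => ?_, fun c hc => ?_, fun c hc => ?_⟩ <;>
            obtain ⟨p, hp, rfl⟩ := List.mem_map.1 hc <;>
            obtain ⟨c, hc, h⟩ := exists_of_forall₂_right s2 hp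
          · by_cases ha : a ∈ c.table.attrs
            · obtain ⟨h1, h2, h3, h4⟩ := h.mem ha
              refine ((hok' c hc).sub h.fst_table h.fst_pos.ge h1.le ?_).tail_of_const
                (by rwa [h.fst_table]) (x := z) (by rwa [h.fst_table])
              rw [h2, ← h.snd_hi]
              exact h3
            · rw [h.notMem ha]
              exact (hok' c hc).tail ha
          · by_cases ha : a ∈ c.table.attrs
            · exact (h.mem ha).1
            · rw [h.notMem ha]
              exact hpos' c hc
          · have := hsize' c hc
            by_cases ha : a ∈ c.table.attrs
            · obtain ⟨h1, h2, h3, h4⟩ := h.mem ha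
              have := h.fst_pos
              have := h.snd_hi
              unfold Cursor.size at *
              omega
            · rw [h.notMem ha]
              exact this
        obtain ⟨b1, b2, b3⟩ := hbody z hz _ hready
        obtain ⟨r1, r2, r3⟩ := ih (z + 1) (bs.map Prod.snd) ts2
          (fun c hc => by
            obtain ⟨p, hp, rfl⟩ := List.mem_map.1 hc
            obtain ⟨c, hc, h⟩ := exists_of_forall₂_right s2 hp
            by_cases ha : a ∈ c.table.attrs
            · obtain ⟨h1, h2, h3, h4⟩ := h.mem ha
              exact (hok' c hc).sub h.snd_table (by rw [← h2, ← h.fst_pos]; exact h1.le) h3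
                h.snd_hi.le
            · rw [h.notMem ha]
              exact hok' c hc)
          (fun c hc hca => by
            obtain ⟨p, hp, rfl⟩ := List.mem_map.1 hc
            obtain ⟨c, hc, h⟩ := exists_of_forall₂_right s2 hp
            rw [h.snd_table] at hca
            rw [h.notMem hca]
            exact hpos' c hc)
          (fun c hc => by
            obtain ⟨p, hp, rfl⟩ := List.mem_map.1 hc
            obtain ⟨c, hc, h⟩ := exists_of_forall₂_right s2 hp
            have := hsize' c hc
            by_cases ha : a ∈ c.table.attrs
            · obtain ⟨h1, h2, h3, h4⟩ := h.mem ha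
              have := h.fst_pos
              have := h.snd_hi
              unfold Cursor.size at *
              omega
            · rw [h.notMem ha]
              exact this)
          (by
            obtain ⟨p, hp, h⟩ := exists_of_forall₂_left s2 hc₀
            obtain ⟨h1, h2, h3, h4⟩ := h.mem ha₀
            refine ⟨p.2, List.mem_map_of_mem hp, by rwa [h.snd_table], fun i hi hi' => ?_⟩
            rw [h.snd_table]
            refine hv₀ i ?_ (by rw [← h.snd_hi]; exact hi')
            rw [← h.fst_pos]
            omega)
        have hcard : (((dom a).filter (z + 1 ≤ ·)).card : ℝ) + 1 ≤
            ((dom a).filter (z ≤ ·)).card := by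
          norm_cast
          refine Finset.card_lt_card ⟨fun v hv => ?_, fun hsub => ?_⟩
          · simp only [Finset.mem_filter] at hv ⊢
            exact ⟨hv.1, by omega⟩
          · have := hsub (Finset.mem_filter.2 ⟨hz, le_rfl⟩)
            simp at this
        -- The domain of `a` is the initial accumulator of weight `y a`: one unit for the value `z`,
        -- the rest for the domain values above it.
        have hold := powProd_add_le hxs
          (bs.map fun p => (decide (a ∈ p.1.table.attrs), p.1.size, p.2.size))
          (fun t ht hf => by
            obtain ⟨p, hp, rfl⟩ := List.mem_map.1 ht
            obtain ⟨c, hc, h⟩ := exists_of_forall₂_right s2 hp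
            simp only [decide_eq_false_iff_not, h.fst_table] at hf
            simp only [h.notMem hf])
          (P := 1) (Q := ((dom a).filter (z + 1 ≤ ·)).card)
          (T := ((dom a).filter (z ≤ ·)).card) (w := y a) zero_le_one (by positivity)
          (by linarith) (hy a) (by
            refine hcov.trans (le_of_eq ?_)
            congr 2
            rw [flags, ← ts1, List.map_map, List.map_map, List.map_map]
            rfl)
        have hsz : cs'.map Cursor.size =
            (bs.map fun p => (decide (a ∈ p.1.table.attrs), p.1.size, p.2.size)).map
              fun t => if t.1 then t.2.1 + t.2.2 else t.2.1 := by
          rw [List.map_map]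
          refine map_eq_map_of_forall₂ (fun c p h => ?_) s2
          simp only [Function.comp, h.fst_table, decide_eq_true_eq]
          split_ifs with ha
          · obtain ⟨h1, h2, h3, h4⟩ := h.mem ha
            have := h.fst_pos
            have := h.snd_hi
            change c.hi - c.pos = (p.1.hi - p.1.pos) + (p.2.hi - p.2.pos)
            omega
          · rw [h.notMem ha]
        rw [← hsz, List.map_map, List.map_map, Real.one_rpow, one_mul] at hold
        have e1 : (bs.map Prod.fst).map Cursor.size = bs.map ((fun t : Bool × ℕ × ℕ => t.2.1) ∘
            fun p => (decide (a ∈ p.1.table.attrs), p.1.size, p.2.size)) := by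
          rw [List.map_map]; rfl
        have e2 : (bs.map Prod.snd).map Cursor.size = bs.map ((fun t : Bool × ℕ × ℕ => t.2.2) ∘
            fun p => (decide (a ∈ p.1.table.attrs), p.1.size, p.2.size)) := by
          rw [List.map_map]; rfl
        rw [← e1, ← e2] at hold
        have hsum : domProd dom y as * powProd xs ((bs.map Prod.fst).map Cursor.size) +
            (((dom a).filter (z + 1 ≤ ·)).card : ℝ) ^ y a *
              (domProd dom y as * powProd xs ((bs.map Prod.snd).map Cursor.size)) ≤
            (((dom a).filter (z ≤ ·)).card : ℝ) ^ y a *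
              (domProd dom y as * powProd xs (cs.map Cursor.size)) := by
          calc _ = domProd dom y as * (powProd xs ((bs.map Prod.fst).map Cursor.size) +
                (((dom a).filter (z + 1 ≤ ·)).card : ℝ) ^ y a *
                  powProd xs ((bs.map Prod.snd).map Cursor.size)) := by ring
            _ ≤ domProd dom y as * ((((dom a).filter (z ≤ ·)).card : ℝ) ^ y a *
                  powProd xs (cs.map Cursor.size)) := by
              refine mul_le_mul_of_nonneg_left (hold.trans ?_) hD
              exact mul_le_mul_of_nonneg_left hmono (by positivity)
            _ = _ := by ring
        refine ⟨?_, ?_, fun r hr => ?_⟩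
        · have hrr : (rounds vals (z + 1) : ℝ) + 1 ≤ rounds vals z := by
            exact_mod_cast rounds_succ_le hzv le_rfl (Nat.le_succ z) (Nat.lt_succ_self z)
          -- `roundCost` is exactly one loop step plus two passes over the iterators, each costing
          -- at most `k * (b + 2) + 1`.
          have hk : ((1 + (leapfrogRound a z cs).time + (openBlocks a z cs').time : ℕ) : ℝ) ≤
              roundCost ts.length b := by
            norm_cast
            unfold roundCost
            nlinarith
          push_cast at hk ⊢
          have hk0 : (0 : ℝ) ≤ roundCost ts.length b := by positivity
          have := mul_le_mul_of_nonneg_left hrr hk0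
          have := mul_le_mul_of_nonneg_left hsum hτ
          linarith
        · rw [List.length_append]
          push_cast
          linarith
        · rcases List.mem_append.1 hr with hr | hr
          · exact b3 r hr
          · exact r3 r hr
      · simp only [if_neg hzx]
        obtain ⟨r1, r2, r3⟩ := ih z cs' hts' hok' (fun c hc _ => hpos' c hc) hsize'
          ⟨c₀, hc₀, ha₀, hv₀⟩
        have hcard : (((dom a).filter (z ≤ ·)).card : ℝ) ≤ ((dom a).filter (x ≤ ·)).card := by
          norm_cast
          refine Finset.card_le_card fun v hv => ?_
          simp only [Finset.mem_filter] at hv ⊢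
          exact ⟨hv.1, by omega⟩
        have hW' := powProd_nonneg xs (cs'.map Cursor.size)
        have hle : (((dom a).filter (z ≤ ·)).card : ℝ) ^ y a *
              (domProd dom y as * powProd xs (cs'.map Cursor.size)) ≤
            (((dom a).filter (x ≤ ·)).card : ℝ) ^ y a *
              (domProd dom y as * powProd xs (cs.map Cursor.size)) :=
          mul_le_mul (Real.rpow_le_rpow (by positivity) hcard (hy a))
            (mul_le_mul_of_nonneg_left hmono hD) (by positivity) (by positivity)
        refine ⟨?_, r2.trans hle, r3⟩
        have hrr : (rounds vals z : ℝ) + 1 ≤ rounds vals x := by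
          exact_mod_cast rounds_succ_le hz₀ hxz₀ hzz₀ (by omega)
        have hk : ((1 + (leapfrogRound a x cs).time : ℕ) : ℝ) ≤ roundCost ts.length b := by
          norm_cast
          unfold roundCost
          nlinarith [Nat.zero_le (ts.length * (b + 2))]
        push_cast at hk ⊢
        have hk0 : (0 : ℝ) ≤ roundCost ts.length b := by positivity
        have := mul_le_mul_of_nonneg_left hrr hk0
        have := mul_le_mul_of_nonneg_left hle hτ
        linarith

end Join

end SPJA

namespace SPJA

open Steps

/-! ### Cost and output size of the whole triejoin. -/

section TrieJoin

theorem annProduct_time {A K : Type} [CommSemiring K] (cs : List (Cursor A K)) : (annProduct cs).time = cs.length + 1 := by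
  induction cs with
  | nil => simp [annProduct]
  | cons c cs ih => simp [annProduct, ih]; omega

theorem Table.cell_of_lt {A K : Type} (T : Table A K) (a : A) {i : ℕ} (hi : i < T.rows.length) :
    T.cell a i = T.rows[i].1 a := by
  simp [Table.cell, hi]

variable {A K : Type} [LinearOrder A]
variable {dom : A → Finset ℕ} {ts : List (Table A K)} {b : ℕ} {xs : List ℝ} {y : A → ℝ}

theorem Ready.dom_nonempty {L : List A} {cs : List (Cursor A K)} (h : Ready dom ts b L cs) {a : A}
    (ha : ∃ T ∈ ts, a ∈ T.attrs) : (dom a).Nonempty := by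
  obtain ⟨T, hT, haT⟩ := ha
  rw [← h.table] at hT
  obtain ⟨c, hc, rfl⟩ := List.mem_map.1 hT
  exact ⟨_, (h.ok c hc).mem_dom _ le_rfl (h.pos c hc) a haT⟩

/-- Some iterator over the attribute `a` has at most as many values as the weighted product. -/
theorem Ready.exists_card_le (hxs : ∀ x ∈ xs, 0 ≤ x) (hlen : xs.length = ts.length)
    (hy : ∀ a, 0 ≤ y a) {a : A} {as : List A} {cs : List (Cursor A K)}
    (h : Ready dom ts b (a :: as) cs) (hcov : 1 ≤ flagSum xs (flags a ts) + y a)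
    (hex : ∀ a' ∈ a :: as, ∃ T ∈ ts, a' ∈ T.attrs) :
    ∃ vals : Finset ℕ, 1 ≤ vals.card ∧
      (∃ c ∈ cs, a ∈ c.table.attrs ∧ ∀ i, c.pos ≤ i → i < c.hi → c.table.cell a i ∈ vals) ∧
      (vals.card : ℝ) ≤ domProd dom y (a :: as) * powProd xs (cs.map Cursor.size) := by
  classical
  let vals : Cursor A K → Finset ℕ := fun c => (Finset.Ico c.pos c.hi).image (c.table.cell a)
  have hex' : ∃ n, ∃ c ∈ cs, a ∈ c.table.attrs ∧ (vals c).card = n := by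
    obtain ⟨T, hT, haT⟩ := hex a List.mem_cons_self
    rw [← h.table] at hT
    obtain ⟨c, hc, rfl⟩ := List.mem_map.1 hT
    exact ⟨_, c, hc, haT, rfl⟩
  -- Take the iterator over `a` with the fewest distinct values, say μ. Every block over `a` then
  -- has at least μ tuples and the domain at least μ values, so the potential is at least μ to a
  -- total weight of at least 1.
  obtain ⟨c, hc, hca, hcn⟩ := Nat.find_spec hex'
  have hmin : ∀ c' ∈ cs, a ∈ c'.table.attrs → (vals c).card ≤ (vals c').card :=
    fun c' hc' ha' => hcn ▸ Nat.find_min' hex' ⟨c', hc', ha', rfl⟩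
  have h1 : 1 ≤ (vals c).card := Finset.card_pos.2
    ⟨_, Finset.mem_image_of_mem _ (Finset.mem_Ico.2 ⟨le_rfl, h.pos c hc⟩)⟩
  refine ⟨vals c, h1, ⟨c, hc, hca, fun i hi hi' =>
    Finset.mem_image_of_mem _ (Finset.mem_Ico.2 ⟨hi, hi'⟩)⟩, ?_⟩
  have hdom : (vals c).card ≤ (dom a).card := by
    refine Finset.card_le_card fun v hv => ?_
    obtain ⟨i, hi, rfl⟩ := Finset.mem_image.1 hv
    rw [Finset.mem_Ico] at hi
    exact (h.ok c hc).mem_dom i hi.1 hi.2 a hca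
  have hp := rpow_flagSum_le_powProd hxs h1
    (cs.map fun c => (decide (a ∈ c.table.attrs), c.size))
    (by rw [hlen, ← h.table, List.length_map, List.length_map])
    (fun t ht => by
      obtain ⟨c', hc', rfl⟩ := List.mem_map.1 ht
      have := h.pos c' hc'
      refine ⟨by unfold Cursor.size; omega, fun ha => ?_⟩
      refine (hmin c' hc' (by simpa using ha)).trans (Finset.card_image_le.trans ?_)
      simp [Cursor.size])
  have hfl : (cs.map fun c => (decide (a ∈ c.table.attrs), c.size)).map Prod.fst = flags a ts := by
    rw [flags, ← h.table, List.map_map, List.map_map]; rfl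
  have hsz : (cs.map fun c => (decide (a ∈ c.table.attrs), c.size)).map Prod.snd =
      cs.map Cursor.size := by
    rw [List.map_map]; rfl
  rw [hfl, hsz] at hp
  have h1' : (1 : ℝ) ≤ ((vals c).card : ℝ) := by exact_mod_cast h1
  have hD : 1 ≤ domProd dom y as := one_le_domProd hy fun a' ha' =>
    h.dom_nonempty (hex a' (List.mem_cons_of_mem _ ha'))
  rw [domProd_cons]
  calc ((vals c).card : ℝ) = ((vals c).card : ℝ) ^ (1 : ℝ) := (Real.rpow_one _).symm
    _ ≤ ((vals c).card : ℝ) ^ (flagSum xs (flags a ts) + y a) :=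
      Real.rpow_le_rpow_of_exponent_le h1' hcov
    _ = ((vals c).card : ℝ) ^ y a * 1 * ((vals c).card : ℝ) ^ flagSum xs (flags a ts) := by
      rw [Real.rpow_add (by linarith)]; ring
    _ ≤ _ := by
      refine mul_le_mul (mul_le_mul ?_ hD zero_le_one (by positivity)) hp (by positivity)
        (mul_nonneg (by positivity) (by linarith))
      exact Real.rpow_le_rpow (by positivity) (by exact_mod_cast hdom) (hy a)

theorem mem_joinAttrs {a : A} : a ∈ joinAttrs ts ↔ ∃ T ∈ ts, a ∈ T.attrs := by
  induction ts with
  | nil => simp [joinAttrs]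
  | cons T ts ih =>
    simp only [joinAttrs, List.foldr_cons, Finset.mem_union, List.mem_cons,
      exists_eq_or_imp] at ih ⊢
    rw [ih]

/-- The global attribute order restricts to each schema's own order, so the stored sorting of a
table serves the triejoin unchanged. -/
theorem filter_mem_sort {S S' : Finset A} (h : S ⊆ S') :
    (S'.sort (· ≤ ·)).filter (· ∈ S) = S.sort (· ≤ ·) := by
  refine List.Perm.eq_of_pairwise (le := (· ≤ ·)) (fun a b _ _ => le_antisymm)
    ((Finset.pairwise_sort S' (· ≤ ·)).filter _) (Finset.pairwise_sort S (· ≤ ·)) ?_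
  rw [List.perm_ext_iff_of_nodup ((Finset.sort_nodup _ _).filter _) (Finset.sort_nodup _ _)]
  intro a
  simp only [List.mem_filter, Finset.mem_sort, decide_eq_true_eq]
  exact ⟨fun h => h.2, fun ha => ⟨h ha, ha⟩⟩

/-- A table is stored as required for a join. -/
structure Table.Stored (dom : A → Finset ℕ) (T : Table A K) : Prop where
  sorted : RowsSorted T.attrs T.rows
  mem_dom : RowsIn dom T.attrs T.rows

variable [CommSemiring K]

/-- Each attribute adds `3 * roundCost` times the potential of the node: its rounds are bounded
through the sparsest iterator, and the levels below are summed by `leapfrog_bound`. At a leaf all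
blocks are nonempty, so the potential is at least 1 and pays for the product of the annotations. -/
theorem trieJoin_bound (hxs : ∀ x ∈ xs, 0 ≤ x) (hlen : xs.length = ts.length) (hy : ∀ a, 0 ≤ y a)
    (L : List A) (hcov : ∀ a ∈ L, 1 ≤ flagSum xs (flags a ts) + y a)
    (hex : ∀ a ∈ L, ∃ T ∈ ts, a ∈ T.attrs) (t : Row A) (cs : List (Cursor A K))
    (h : Ready dom ts b L cs) :
    ((trieJoin L t cs).time : ℝ) ≤ (3 * L.length * roundCost ts.length b + (ts.length + 1)) *
        (domProd dom y L * powProd xs (cs.map Cursor.size)) ∧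
      ((trieJoin L t cs).val.length : ℝ) ≤ domProd dom y L * powProd xs (cs.map Cursor.size) ∧
      ∀ r ∈ (trieJoin L t cs).val, (∀ a ∈ L, r.1 a ∈ dom a) ∧ ∀ a ∉ L, r.1 a = t a := by
  induction L generalizing t cs with
  | nil =>
    have hW : 1 ≤ powProd xs (cs.map Cursor.size) := one_le_powProd hxs fun n hn => by
      obtain ⟨c, hc, rfl⟩ := List.mem_map.1 hn
      have := h.pos c hc
      unfold Cursor.size
      omega
    have hk : cs.length = ts.length := by rw [← h.table, List.length_map]
    simp only [trieJoin, bind_time, bind_val, pure_time, pure_val, annProduct_time, hk, domProd]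
    refine ⟨?_, by simpa using hW, by simp⟩
    simp only [List.length_nil, List.map_nil, List.prod_nil]
    push_cast
    nlinarith
  | cons a as ih =>
    obtain ⟨vals, hv1, hvals, hle⟩ := h.exists_card_le hxs hlen hy (hcov a List.mem_cons_self) hex
    have hτ : (0 : ℝ) ≤ 3 * as.length * roundCost ts.length b + (ts.length + 1) := by positivity
    obtain ⟨r1, r2, r3⟩ := leapfrog_bound hxs hy (hcov a List.mem_cons_self)
      (body := fun x cs' => trieJoin as (Function.update t a x) cs') hτ
      (P := fun r => (∀ a' ∈ a :: as, r.1 a' ∈ dom a') ∧ ∀ a' ∉ a :: as, r.1 a' = t a')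
      (fun x hx cs' hcs' => by
        obtain ⟨i1, i2, i3⟩ := ih (fun a' ha' => hcov a' (List.mem_cons_of_mem _ ha'))
          (fun a' ha' => hex a' (List.mem_cons_of_mem _ ha')) (Function.update t a x) cs' hcs'
        refine ⟨i1, i2, fun r hr => ⟨fun a' ha' => ?_, fun a' ha' => ?_⟩⟩
        · obtain ⟨j1, j2⟩ := i3 r hr
          by_cases hmem : a' ∈ as
          · exact j1 a' hmem
          · rw [j2 a' hmem]
            rcases List.mem_cons.1 ha' with rfl | h'
            · simpa using hx
            · exact absurd h' hmem
        · obtain ⟨j1, j2⟩ := i3 r hr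
          simp only [List.mem_cons, not_or] at ha'
          rw [j2 a' ha'.2, Function.update_of_ne ha'.1])
      vals (roundBound cs) 0 cs h.table h.ok (fun c hc _ => h.pos c hc) h.size hvals
    simp only [Nat.zero_le, Finset.filter_true, ← mul_assoc, ← domProd_cons] at r1 r2
    rw [trieJoin]
    refine ⟨r1.trans ?_, r2, r3⟩
    -- At most two rounds per value plus one, and `vals` is nonempty.
    have hrd : (rounds vals 0 : ℝ) ≤ 3 * vals.card := by
      have : rounds vals 0 ≤ 3 * vals.card := by
        unfold rounds
        simp only [Nat.zero_le, Finset.filter_true]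
        split_ifs <;> omega
      exact_mod_cast this
    have hk0 : (0 : ℝ) ≤ roundCost ts.length b := by positivity
    have e : (rounds vals 0 : ℝ) ≤ 3 * (domProd dom y (a :: as) *
        powProd xs (cs.map Cursor.size)) := hrd.trans (by linarith)
    have := mul_le_mul_of_nonneg_left e hk0
    rw [List.length_cons, domProd_cons] at *
    push_cast
    linarith

theorem leapfrogTriejoin_of_empty (h : ∃ T ∈ ts, T.rows = []) :
    (leapfrogTriejoin ts).time = ts.length ∧ (leapfrogTriejoin ts).val = [] := by
  have : ts.any (fun T => T.rows.isEmpty) = true := by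
    obtain ⟨T, hT, hT'⟩ := h
    exact List.any_eq_true.2 ⟨T, hT, by simp [hT']⟩
  simp only [leapfrogTriejoin, bind_time, bind_val, tick_time, if_pos this, pure_time, pure_val]
  exact ⟨by omega, trivial⟩

theorem leapfrogTriejoin_of_nonempty (hst : ∀ T ∈ ts, T.Stored dom)
    (hsize : ∀ T ∈ ts, T.rows.length < 2 ^ b) (hne : ∀ T ∈ ts, T.rows ≠ [])
    (hxs : ∀ x ∈ xs, 0 ≤ x) (hlen : xs.length = ts.length) (hy : ∀ a, 0 ≤ y a)
    (hcov : ∀ a ∈ joinAttrs ts, 1 ≤ flagSum xs (flags a ts) + y a) :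
    ((leapfrogTriejoin ts).time : ℝ) ≤ ts.length +
        (3 * (joinAttrs ts).card * roundCost ts.length b + (ts.length + 1) + (joinAttrs ts).card) *
        (domProd dom y ((joinAttrs ts).sort (· ≤ ·)) * powProd xs (ts.map (·.rows.length))) ∧
      ((leapfrogTriejoin ts).val.length : ℝ) ≤
        domProd dom y ((joinAttrs ts).sort (· ≤ ·)) * powProd xs (ts.map (·.rows.length)) ∧
      RowsIn dom (joinAttrs ts) (leapfrogTriejoin ts).val := by
  have hany : ¬ ts.any (fun T => T.rows.isEmpty) = true := by
    rw [List.any_eq_true]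
    rintro ⟨T, hT, hT'⟩
    exact hne T hT (by simpa using hT')
  have hready : Ready dom ts b ((joinAttrs ts).sort (· ≤ ·))
      (ts.map fun T => ⟨T, 0, T.rows.length⟩) := by
    refine ⟨by rw [List.map_map]; exact List.map_id _, fun c hc => ?_, fun c hc => ?_,
      fun c hc => ?_⟩ <;> obtain ⟨T, hT, rfl⟩ := List.mem_map.1 hc
    · refine ⟨Nat.zero_le _, fun i j _ hij hj => ?_, fun i _ hi a ha => ?_⟩
      · change j < T.rows.length at hj
        rw [filter_mem_sort fun a ha => mem_joinAttrs.2 ⟨T, hT, ha⟩]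
        simp only [Table.cell_of_lt T _ hj, Table.cell_of_lt T _ (hij.trans_lt hj)]
        rcases hij.eq_or_lt with rfl | hij
        · exact le_rfl
        · exact List.pairwise_iff_getElem.1 (hst T hT).sorted i j (hij.trans hj) hj hij
      · change i < T.rows.length at hi
        simp only [Table.cell_of_lt T _ hi]
        exact (hst T hT).mem_dom _ (List.getElem_mem hi) a ha
    · exact List.length_pos_iff.2 (hne T hT)
    · exact hsize T hT
  obtain ⟨r1, r2, r3⟩ := trieJoin_bound hxs hlen hy ((joinAttrs ts).sort (· ≤ ·))
    (fun a ha => hcov a ((Finset.mem_sort _).1 ha))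
    (fun a ha => mem_joinAttrs.1 ((Finset.mem_sort _).1 ha)) (fun _ => 0) _ hready
  have hsz : (ts.map fun T => (⟨T, 0, T.rows.length⟩ : Cursor A K)).map Cursor.size =
      ts.map (·.rows.length) := by
    rw [List.map_map]; rfl
  rw [hsz] at r1 r2
  rw [Finset.length_sort] at r1
  simp only [leapfrogTriejoin, bind_time, bind_val, tick_time, if_neg hany, pure_time, pure_val]
  refine ⟨?_, r2, fun r hr a ha => (r3 r hr).1 a ((Finset.mem_sort _).2 ha)⟩
  have := mul_le_mul_of_nonneg_left r2 (Nat.cast_nonneg (α := ℝ) (joinAttrs ts).card)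
  push_cast
  linarith

end TrieJoin

end SPJA

namespace SPJA

open Steps

/-! ### From bit lengths to logarithms, and the costs of join, aggregation and sort. -/

/-- The bit length exceeds the binary logarithm by at most 1, which log(1 + n) ≥ log 2 absorbs; the
constant 3 works because 2 / log 2 < 3. -/
theorem size_le_log {n : ℕ} (hn : 1 ≤ n) : (n.size : ℝ) ≤ 3 * Real.log (1 + n) := by
  have h2 := Real.log_two_gt_d9
  have hn' : (1 : ℝ) ≤ n := by exact_mod_cast hn
  have hpos : 0 < n.size := Nat.size_pos.2 hn
  have h1 : 2 ^ (n.size - 1) ≤ n := Nat.lt_size.1 (by omega)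
  have h3 : ((n.size : ℝ) - 1) * Real.log 2 ≤ Real.log (1 + n) := by
    have : ((n.size - 1 : ℕ) : ℝ) * Real.log 2 ≤ Real.log (1 + n) := by
      rw [← Real.log_pow]
      exact Real.log_le_log (by positivity) (by
        have : ((2 : ℝ) ^ (n.size - 1)) ≤ n := by exact_mod_cast h1
        linarith)
    rwa [Nat.cast_sub hpos, Nat.cast_one] at this
  have h4 : Real.log 2 ≤ Real.log (1 + n) := Real.log_le_log (by norm_num) (by linarith)
  nlinarith

theorem one_le_log {M : ℝ} (hM : 1 ≤ M) : 1 ≤ 3 / 2 * Real.log (1 + M) := by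
  have h2 := Real.log_two_gt_d9
  have h4 : Real.log 2 ≤ Real.log (1 + M) := Real.log_le_log (by norm_num) (by linarith)
  linarith

theorem powProd_replicate_zero (k : ℕ) (ns : List ℕ) : powProd (List.replicate k 0) ns = 1 := by
  induction k generalizing ns with
  | zero => simp
  | succ k ih =>
    cases ns with
    | nil => simp
    | cons n ns => rw [List.replicate_succ, powProd_cons, ih]; simp

theorem powProd_replicate_one_le {M : ℝ} (k : ℕ) (ns : List ℕ) (h : k = ns.length)
    (hns : ∀ n ∈ ns, (n : ℝ) ≤ M) : powProd (List.replicate k 1) ns ≤ M ^ k := by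
  induction k generalizing ns with
  | zero => simp
  | succ k ih =>
    cases ns with
    | nil => simp at h
    | cons n ns =>
      simp only [List.forall_mem_cons] at hns
      rw [List.replicate_succ, powProd_cons, pow_succ', Real.rpow_one]
      exact mul_le_mul hns.1 (ih ns (by simpa using h) hns.2) (powProd_nonneg _ _)
        ((Nat.cast_nonneg n).trans hns.1)

theorem one_le_flagSum_replicate (fs : List Bool) (h : true ∈ fs) :
    1 ≤ flagSum (List.replicate fs.length 1) fs := by
  have h0 : ∀ fs : List Bool, 0 ≤ flagSum (List.replicate fs.length 1) fs := fun fs => by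
    induction fs with
    | nil => simp
    | cons f fs ih =>
      rw [List.length_cons, List.replicate_succ, flagSum_cons]
      split_ifs <;> linarith
  induction fs with
  | nil => simp at h
  | cons f fs ih =>
    rw [List.length_cons, List.replicate_succ, flagSum_cons]
    cases f with
    | true => simpa using h0 fs
    | false => simpa using ih (by simpa using h)

section Costs

theorem domProd_zero {A : Type} (dom : A → Finset ℕ) (L : List A) : domProd dom (fun _ => 0) L = 1 := by
  simp [domProd]

theorem exists_size_bound {A K : Type} (ts : List (Table A K)) : ∃ b, ∀ T ∈ ts, T.rows.length < 2 ^ b := by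
  refine ⟨(ts.map (·.rows.length)).sum, fun T hT => ?_⟩
  exact (List.single_le_sum (by simp) T.rows.length
    (List.mem_map_of_mem (f := (·.rows.length)) hT)).trans_lt Nat.lt_two_pow_self

variable {A K : Type} [LinearOrder A] [CommSemiring K]
variable {dom : A → Finset ℕ} {ts : List (Table A K)} {xs : List ℝ} {y : A → ℝ} {M : ℝ}

theorem leapfrogTriejoin_rowsIn (hst : ∀ T ∈ ts, T.Stored dom) :
    RowsIn dom (joinAttrs ts) (leapfrogTriejoin ts).val := by
  by_cases hne : ∃ T ∈ ts, T.rows = []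
  · rw [(leapfrogTriejoin_of_empty hne).2]
    simp [RowsIn]
  · push Not at hne
    obtain ⟨b, hb⟩ := exists_size_bound ts
    -- Only the domain statement is used, so any valid weights do; all ones is the simplest choice.
    exact (leapfrogTriejoin_of_nonempty hst hb hne (xs := List.replicate ts.length 1)
      (y := fun _ => 1) (fun x hx => by rw [List.eq_of_mem_replicate hx]; norm_num) (by simp)
      (fun _ => zero_le_one) (fun a ha => by
        have : 1 ≤ flagSum (List.replicate ts.length 1) (flags a ts) := by
          have := one_le_flagSum_replicate (flags a ts) (by
            obtain ⟨T, hT, haT⟩ := mem_joinAttrs.1 ha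
            exact List.mem_map.2 ⟨T, hT, by simpa using haT⟩)
          rwa [show (flags a ts).length = ts.length by simp [flags]] at this
        linarith)).2.2

theorem leapfrogTriejoin_length_le (hst : ∀ T ∈ ts, T.Stored dom)
    (hxs : ∀ x ∈ xs, 0 ≤ x) (hlen : xs.length = ts.length) (hy : ∀ a, 0 ≤ y a)
    (hcov : ∀ a ∈ joinAttrs ts, 1 ≤ flagSum xs (flags a ts) + y a) :
    ((leapfrogTriejoin ts).val.length : ℝ) ≤
      domProd dom y ((joinAttrs ts).sort (· ≤ ·)) * powProd xs (ts.map (·.rows.length)) := by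
  by_cases hne : ∃ T ∈ ts, T.rows = []
  · rw [(leapfrogTriejoin_of_empty hne).2]
    simpa using mul_nonneg (domProd_nonneg _ _ _) (powProd_nonneg _ _)
  · push Not at hne
    obtain ⟨b, hb⟩ := exists_size_bound ts
    exact (leapfrogTriejoin_of_nonempty hst hb hne hxs hlen hy hcov).2.1

/-- Weight 1 on every table is always a cover. This crude bound is used only inside the logarithm of
the sorting cost. -/
theorem leapfrogTriejoin_length_le_pow (hst : ∀ T ∈ ts, T.Stored dom)
    (hM : ∀ T ∈ ts, (T.rows.length : ℝ) ≤ M) :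
    ((leapfrogTriejoin ts).val.length : ℝ) ≤ M ^ ts.length := by
  refine (leapfrogTriejoin_length_le hst (xs := List.replicate ts.length 1) (y := fun _ => 0)
    (fun x hx => by rw [List.eq_of_mem_replicate hx]; norm_num) (by simp) (fun _ => le_rfl)
    (fun a ha => ?_)).trans ?_
  · rw [add_zero]
    have := one_le_flagSum_replicate (flags a ts) (by
      obtain ⟨T, hT, haT⟩ := mem_joinAttrs.1 ha
      exact List.mem_map.2 ⟨T, hT, by simpa using haT⟩)
    rwa [show (flags a ts).length = ts.length by simp [flags]] at this
  · rw [domProd_zero, one_mul]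
    refine powProd_replicate_one_le _ _ (by simp) fun n hn => ?_
    obtain ⟨T, hT, rfl⟩ := List.mem_map.1 hn
    exact hM T hT

/-- With no attributes, zero weights cover vacuously and the potential is 1. This case needs its own
treatment below, because cost terms with the number of attributes as a factor vanish. -/
theorem leapfrogTriejoin_length_le_one (hst : ∀ T ∈ ts, T.Stored dom)
    (h : (joinAttrs ts).card = 0) : (leapfrogTriejoin ts).val.length ≤ 1 := by
  rw [Finset.card_eq_zero] at h
  have := leapfrogTriejoin_length_le hst (xs := List.replicate ts.length 0) (y := fun _ => 0)
    (fun x hx => by rw [List.eq_of_mem_replicate hx]) (by simp) (fun _ => le_rfl)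
    (fun a ha => by simp [h] at ha)
  rw [domProd_zero, powProd_replicate_zero, one_mul] at this
  exact_mod_cast this

theorem ne_nil_of_leapfrogTriejoin_ne_nil (h : (leapfrogTriejoin ts).val ≠ []) :
    ∀ T ∈ ts, T.rows ≠ [] := by
  intro T hT h'
  exact h (leapfrogTriejoin_of_empty ⟨T, hT, h'⟩).2

/-- The term `3 * ts.length` pays for the emptiness test and for joins without attributes, where the
product may be 0. Otherwise `M ≥ 1`, the search depth is the bit length of `⌊M⌋₊`, and each additive
constant is at most 3/2 log(1 + M). -/
theorem leapfrogTriejoin_time_le (hts : ts ≠ []) (hst : ∀ T ∈ ts, T.Stored dom)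
    (hM : ∀ T ∈ ts, (T.rows.length : ℝ) ≤ M)
    (hxs : ∀ x ∈ xs, 0 ≤ x) (hlen : xs.length = ts.length) (hy : ∀ a, 0 ≤ y a)
    (hcov : ∀ a ∈ joinAttrs ts, 1 ≤ flagSum xs (flags a ts) + y a) {W : ℝ}
    (hW : domProd dom y ((joinAttrs ts).sort (· ≤ ·)) * powProd xs (ts.map (·.rows.length)) ≤ W) :
    ((leapfrogTriejoin ts).time : ℝ) ≤ 3 * ts.length +
      60 * (ts.length * (joinAttrs ts).card * W * Real.log (1 + M)) := by
  have hk : (1 : ℝ) ≤ ts.length := by exact_mod_cast List.length_pos_iff.2 hts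
  have hW0 : 0 ≤ W := (mul_nonneg (domProd_nonneg _ _ _) (powProd_nonneg _ _)).trans hW
  obtain ⟨T₀, hT₀⟩ := List.exists_mem_of_ne_nil ts hts
  have hM0 : 0 ≤ M := (Nat.cast_nonneg _).trans (hM T₀ hT₀)
  have hℓ : 0 ≤ Real.log (1 + M) := Real.log_nonneg (by linarith)
  by_cases hne : ∃ T ∈ ts, T.rows = []
  · rw [(leapfrogTriejoin_of_empty hne).1]
    have : 0 ≤ 60 * (ts.length * (joinAttrs ts).card * W * Real.log (1 + M)) := by positivity
    linarith
  push Not at hne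
  by_cases h0 : (joinAttrs ts).card = 0
  · obtain ⟨b, hb⟩ := exists_size_bound ts
    have := (leapfrogTriejoin_of_nonempty hst hb hne (xs := List.replicate ts.length 0)
      (y := fun _ => 0) (fun x hx => by rw [List.eq_of_mem_replicate hx]) (by simp)
      (fun _ => le_rfl) (fun a ha => by simp [Finset.card_eq_zero.1 h0] at ha)).1
    rw [domProd_zero, powProd_replicate_zero, h0] at this
    rw [h0]
    simp only [Nat.cast_zero, mul_zero, zero_mul, zero_add, mul_one, add_zero] at this ⊢
    linarith
  have hα : (1 : ℝ) ≤ (joinAttrs ts).card := by exact_mod_cast Nat.one_le_iff_ne_zero.2 h0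
  have hM1 : 1 ≤ M := by
    refine le_trans ?_ (hM T₀ hT₀)
    exact_mod_cast List.length_pos_iff.2 (hne T₀ hT₀)
  have hfl : 1 ≤ ⌊M⌋₊ := (Nat.one_le_floor_iff M).2 hM1
  have hb : ∀ T ∈ ts, T.rows.length < 2 ^ (⌊M⌋₊).size := fun T hT =>
    (Nat.le_floor (hM T hT)).trans_lt (Nat.lt_size_self _)
  have hsz : ((⌊M⌋₊.size : ℕ) : ℝ) ≤ 3 * Real.log (1 + M) := by
    refine (size_le_log hfl).trans ?_
    have := Nat.floor_le hM0
    have : Real.log (1 + ⌊M⌋₊) ≤ Real.log (1 + M) :=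
      Real.log_le_log (by positivity) (by linarith)
    linarith
  have h1 := one_le_log hM1
  have key := (leapfrogTriejoin_of_nonempty hst hb hne hxs hlen hy hcov).1
  generalize (leapfrogTriejoin ts).time = t at *
  generalize Real.log (1 + M) = ℓ at *
  generalize ((joinAttrs ts).card : ℝ) = α at *
  generalize hkk : (ts.length : ℝ) = k at *
  have hrc : (roundCost ts.length ⌊M⌋₊.size : ℝ) ≤ 17 * (k * ℓ) := by
    unfold roundCost
    push_cast
    rw [hkk]
    have e1 : k * (⌊M⌋₊.size : ℝ) ≤ k * (3 * ℓ) := by gcongr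
    have e2 : k * 1 ≤ k * (3 / 2 * ℓ) := by gcongr
    nlinarith
  have hkℓ : 0 ≤ k * ℓ := by positivity
  have f1 : α * (roundCost ts.length ⌊M⌋₊.size : ℝ) ≤ α * (17 * (k * ℓ)) := by gcongr
  have f2 : k ≤ α * (3 / 2 * (k * ℓ)) := by
    have : k * 1 ≤ k * (3 / 2 * ℓ) := by gcongr
    have : 1 * (3 / 2 * (k * ℓ)) ≤ α * (3 / 2 * (k * ℓ)) := by gcongr
    linarith
  have f3 : α ≤ α * (3 / 2 * (k * ℓ)) := by
    have : 1 * (3 / 2 * ℓ) ≤ k * (3 / 2 * ℓ) := by gcongr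
    have : α * 1 ≤ α * (3 / 2 * (k * ℓ)) := by gcongr; linarith
    linarith
  -- The rounds contribute 3 · 17 = 51, and `k`, 1 and `α` at most 3/2 each, below 60 in total.
  have hco : 3 * α * (roundCost ts.length ⌊M⌋₊.size : ℝ) + (k + 1) + α ≤ 60 * (α * (k * ℓ)) := by
    linarith
  have hco0 : 0 ≤ 3 * α * (roundCost ts.length ⌊M⌋₊.size : ℝ) + (k + 1) + α := by positivity
  calc (t : ℝ) ≤ _ := key
    _ ≤ k + 60 * (α * (k * ℓ)) * W := by
      gcongr
      exact (mul_nonneg (domProd_nonneg _ _ _) (powProd_nonneg _ _))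
    _ ≤ _ := by linarith

/-- The cost of aggregating the result of a join. -/
theorem hashAggregate_join_time_le (hts : ts ≠ []) (hst : ∀ T ∈ ts, T.Stored dom)
    (hM : ∀ T ∈ ts, (T.rows.length : ℝ) ≤ M) {W : ℝ}
    (hW : ((leapfrogTriejoin ts).val.length : ℝ) ≤ W) (S : Finset A)
    (hS : S.card ≤ (joinAttrs ts).card) :
    ((hashAggregate S [] (leapfrogTriejoin ts).val).time : ℝ) ≤ 2 +
      3 * (ts.length * (joinAttrs ts).card * W * Real.log (1 + M)) := by
  have hk : (1 : ℝ) ≤ ts.length := by exact_mod_cast List.length_pos_iff.2 hts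
  have hW0 : 0 ≤ W := (Nat.cast_nonneg _).trans hW
  obtain ⟨T₀, hT₀⟩ := List.exists_mem_of_ne_nil ts hts
  have hM0 : 0 ≤ M := (Nat.cast_nonneg _).trans (hM T₀ hT₀)
  have hℓ : 0 ≤ Real.log (1 + M) := Real.log_nonneg (by linarith)
  have hR : 0 ≤ ts.length * (joinAttrs ts).card * W * Real.log (1 + M) := by positivity
  rw [hashAggregate_time]
  by_cases hout : (leapfrogTriejoin ts).val = []
  · rw [hout]
    push_cast
    simp only [List.length_nil, Nat.cast_zero, mul_zero]
    linarith
  have hne := ne_nil_of_leapfrogTriejoin_ne_nil hout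
  have hM1 : 1 ≤ M := by
    refine le_trans ?_ (hM T₀ hT₀)
    exact_mod_cast List.length_pos_iff.2 (hne T₀ hT₀)
  have h1 := one_le_log hM1
  by_cases h0 : (joinAttrs ts).card = 0
  · have hl := leapfrogTriejoin_length_le_one hst h0
    have hS0 : S.card = 0 := by omega
    rw [hS0]
    have : ((leapfrogTriejoin ts).val.length : ℝ) ≤ 1 := by exact_mod_cast hl
    push_cast
    linarith
  · have hα : (1 : ℝ) ≤ (joinAttrs ts).card := by exact_mod_cast Nat.one_le_iff_ne_zero.2 h0
    have hSα : (S.card : ℝ) ≤ (joinAttrs ts).card := by exact_mod_cast hS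
    push_cast
    generalize ((leapfrogTriejoin ts).val.length : ℝ) = n at *
    generalize Real.log (1 + M) = ℓ at *
    generalize ((joinAttrs ts).card : ℝ) = α at *
    generalize (ts.length : ℝ) = k at *
    have e1 : (S.card + 1 : ℝ) * n ≤ (2 * α) * W := by
      have hn : (0 : ℝ) ≤ S.card + 1 := by positivity
      calc (S.card + 1 : ℝ) * n ≤ (S.card + 1) * W := by gcongr
        _ ≤ _ := by gcongr; linarith
    have e2 : (2 * α) * W * 1 ≤ (2 * α) * W * (k * (3 / 2 * ℓ)) := by
      gcongr
      calc (1 : ℝ) ≤ 3 / 2 * ℓ := h1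
        _ = 1 * (3 / 2 * ℓ) := by ring
        _ ≤ _ := by gcongr
    nlinarith

/-- The cost of sorting at most as many tuples as there are in the result of a join. -/
theorem sortRows_join_time_le (hts : ts ≠ []) (hst : ∀ T ∈ ts, T.Stored dom)
    (hM : ∀ T ∈ ts, (T.rows.length : ℝ) ≤ M) {W : ℝ}
    (hW : ((leapfrogTriejoin ts).val.length : ℝ) ≤ W) (S : Finset A)
    (hS : S.card ≤ (joinAttrs ts).card) (l : List (Row A × K))
    (hl : l.length ≤ (leapfrogTriejoin ts).val.length) :
    ((sortRows S l).time : ℝ) ≤ 1 +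
      15 * (ts.length * (joinAttrs ts).card * W * Real.log (1 + M)) := by
  have hk : 1 ≤ ts.length := List.length_pos_iff.2 hts
  have hW0 : 0 ≤ W := (Nat.cast_nonneg _).trans hW
  obtain ⟨T₀, hT₀⟩ := List.exists_mem_of_ne_nil ts hts
  have hM0 : 0 ≤ M := (Nat.cast_nonneg _).trans (hM T₀ hT₀)
  have hℓ : 0 ≤ Real.log (1 + M) := Real.log_nonneg (by linarith)
  have hR : 0 ≤ ts.length * (joinAttrs ts).card * W * Real.log (1 + M) := by positivity
  have hs := (sortRows_spec S l).1
  by_cases hl1 : l.length ≤ 1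
  · have h0 : ((sortRows S l).time : ℝ) ≤ 1 := by exact_mod_cast hs 0 (by simpa using hl1)
    linarith
  have h0 : (joinAttrs ts).card ≠ 0 := fun h0 => by
    have := leapfrogTriejoin_length_le_one hst h0
    omega
  have hα : (1 : ℝ) ≤ (joinAttrs ts).card := by exact_mod_cast Nat.one_le_iff_ne_zero.2 h0
  have hSα : (S.card : ℝ) ≤ (joinAttrs ts).card := by exact_mod_cast hS
  have hlM : (l.length : ℝ) ≤ M ^ ts.length :=
    (Nat.cast_le.2 hl).trans (leapfrogTriejoin_length_le_pow hst hM)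
  -- From n ≤ M^k one gets 1 + n ≤ (1 + M)^k, so the sorting logarithm costs only the factor k.
  have hlog : Real.log (1 + l.length) ≤ ts.length * Real.log (1 + M) := by
    rw [← Real.log_pow]
    refine Real.log_le_log (by positivity) ?_
    have : (1 : ℝ) ^ ts.length + M ^ ts.length ≤ (1 + M) ^ ts.length :=
      pow_add_pow_le zero_le_one hM0 (by omega)
    rw [one_pow] at this
    linarith
  have h2 : ((sortRows S l).time : ℝ) ≤ (S.card + 4) * l.length * l.length.size + 1 := by
    exact_mod_cast hs _ (Nat.lt_size_self l.length).le
  have h3 := size_le_log (n := l.length) (by omega)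
  have hlW : (l.length : ℝ) ≤ W := (Nat.cast_le.2 hl).trans hW
  calc ((sortRows S l).time : ℝ) ≤ _ := h2
    _ ≤ (5 * (joinAttrs ts).card) * W * (3 * (ts.length * Real.log (1 + M))) + 1 := by
      gcongr
      · linarith
      · linarith
    _ = _ := by ring

end Costs

end SPJA

/-! ### Distances to the root of a tree. -/

/-- Each neighbour nearer to `r` extends to a shortest walk from `u`, which is a path; a tree has
only one. -/
theorem SimpleGraph.IsTree.eq_of_adj_of_dist_eq_add_one {V : Type} {G : SimpleGraph V}
    (hG : G.IsTree) {r u w w' : V} (h : G.Adj u w) (hd : G.dist u r = G.dist w r + 1)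
    (h' : G.Adj u w') (hd' : G.dist u r = G.dist w' r + 1) : w = w' := by
  obtain ⟨p, hp⟩ := hG.connected.exists_walk_length_eq_dist w r
  obtain ⟨q, hq⟩ := hG.connected.exists_walk_length_eq_dist w' r
  have h1 : (SimpleGraph.Walk.cons h p).IsPath :=
    SimpleGraph.Walk.isPath_of_length_eq_dist _ (by simp [hp, hd])
  have h2 : (SimpleGraph.Walk.cons h' q).IsPath :=
    SimpleGraph.Walk.isPath_of_length_eq_dist _ (by simp [hq, hd'])
  have := congrArg SimpleGraph.Walk.snd ((hG.existsUnique_path u r).unique h1 h2)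
  simpa using this

theorem SimpleGraph.Connected.exists_adj_dist_eq_add_one {V : Type} {G : SimpleGraph V}
    (hG : G.Connected) {r u : V} (h : u ≠ r) :
    ∃ w, G.Adj u w ∧ G.dist u r = G.dist w r + 1 := by
  obtain ⟨p, hp⟩ := hG.exists_walk_length_eq_dist u r
  cases p with
  | nil => exact absurd rfl h
  | @cons _ w _ hadj q =>
    refine ⟨w, hadj, ?_⟩
    have h1 := G.dist_le q
    have h2 := hG.dist_triangle (u := u) (v := w) (w := r)
    rw [SimpleGraph.dist_eq_one_iff_adj.2 hadj] at h2
    rw [SimpleGraph.Walk.length_cons] at hp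
    omega

theorem SimpleGraph.Connected.dist_lt_card {V : Type} [Fintype V] {G : SimpleGraph V}
    (hG : G.Connected) (u r : V) : G.dist u r < Fintype.card V := by
  obtain ⟨p, hp, hl⟩ := hG.exists_path_of_dist u r
  rw [← hl]
  exact hp.length_lt

theorem Finset.prod_map_sort {ι M : Type} [LinearOrder ι] [CommMonoid M] (s : Finset ι)
    (f : ι → M) : ((s.sort (· ≤ ·)).map f).prod = ∏ i ∈ s, f i := by
  rw [← Multiset.prod_coe, ← Multiset.map_coe, Finset.sort_eq]
  rfl

theorem Finset.sum_map_sort {ι M : Type} [LinearOrder ι] [AddCommMonoid M] (s : Finset ι)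
    (f : ι → M) : ((s.sort (· ≤ ·)).map f).sum = ∑ i ∈ s, f i := by
  rw [← Multiset.sum_coe, ← Multiset.map_coe, Finset.sort_eq]
  rfl

namespace SPJA

namespace Query

open Steps

variable {V A K : Type} [Fintype V] [LinearOrder A] [CommSemiring K]
variable (Q : Query V A K)

/-! ### Selections -/

/-- The number of selected tuples of a bag. -/
def numSelected (u : V) : ℕ := ((Q.rel u).filter fun r => Q.sel u r.1).length

theorem select_val (u : V) :
    (Q.select u).val = ⟨Q.bag u, (Q.rel u).filter fun r => Q.sel u r.1⟩ := by
  simp [select, filterRows_val]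

theorem select_time (u : V) : (Q.select u).time = Q.size u + 1 := by
  simp [select, filterRows_time, size]

theorem one_le_size (u : V) : 1 ≤ Q.size u := List.length_pos_iff.2 (Q.rel_nonempty u)

theorem selectivity_mul_size (u : V) : Q.selectivity u * Q.size u = Q.numSelected u := by
  have : (Q.size u : ℝ) ≠ 0 := by
    have := Q.one_le_size u
    positivity
  rw [selectivity, div_mul_cancel₀ _ this]
  rfl

theorem select_stored (u : V) : (Q.select u).val.Stored Q.dom := by
  rw [select_val]
  refine ⟨?_, fun r hr a ha => Q.rel_dom u r (List.mem_filter.1 hr).1 a ha⟩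
  exact ((Q.rel_sorted u).imp fun h => h.le).filter _

theorem bag_subset_attrs {Q : Query V A K} (u : V) : Q.bag u ⊆ Q.attrs :=
  Finset.subset_biUnion_of_mem Q.bag (Finset.mem_univ u)

/-- The weights of the attributes in the size bound of a message: those outside the bag `u` range
over their domains. -/
def domWeight (u : V) (a : A) : ℝ := if a ∈ Q.bag u then 0 else 1

theorem domWeight_nonneg {Q : Query V A K} {u : V} (a : A) : 0 ≤ Q.domWeight u a := by
  unfold domWeight
  split_ifs <;> norm_num

variable [LinearOrder V]

/-! ### The tree with root `r` -/

/-- The bag `u` passes its message to `p` when messages are passed to the root `r`. -/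
def IsUp (r u : V) (p : Option V) : Prop :=
  p = none ∧ u = r ∨ ∃ w, p = some w ∧ Q.tree.Adj u w ∧ Q.tree.dist u r = Q.tree.dist w r + 1

variable {Q}

/-- Adjacent bags of a tree differ by exactly one in distance to `r`, and only one neighbour is
nearer, namely the receiver. So the incoming neighbours are precisely the children. -/
theorem IsUp.mem_inNbrs {r u : V} {p : Option V} (h : Q.IsUp r u p) {i : V} :
    i ∈ Q.inNbrs u p ↔ Q.tree.Adj i u ∧ Q.tree.dist i r = Q.tree.dist u r + 1 := by
  simp only [inNbrs, Finset.mem_filter, Finset.mem_univ, true_and]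
  refine and_congr_right fun hadj => ⟨fun hne => ?_, fun hd hp => ?_⟩
  · have hd := Q.isTree.dist_eq_dist_add_one_of_adj r hadj
    rw [SimpleGraph.dist_comm, SimpleGraph.dist_comm (u := r)] at hd
    refine hd.resolve_right fun hd' => ?_
    rcases h with ⟨rfl, rfl⟩ | ⟨w, rfl, hw, hwd⟩
    · rw [SimpleGraph.dist_self] at hd'
      omega
    · exact hne (congrArg some (Q.isTree.eq_of_adj_of_dist_eq_add_one hadj.symm hd' hw hwd))
  · rcases h with ⟨rfl, rfl⟩ | ⟨w, rfl, hw, hwd⟩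
    · simp at hp
    · simp only [Option.some.injEq] at hp
      subst hp
      omega

theorem IsUp.child {r u : V} {p : Option V} (h : Q.IsUp r u p) {i : V}
    (hi : i ∈ Q.inNbrs u p) : Q.IsUp r i (some u) :=
  Or.inr ⟨u, rfl, h.mem_inNbrs.1 hi⟩

/-- Each recursive call moves one step away from `r`, and distances stay below `Fintype.card V`. Any
two depth bounds covering the remaining levels therefore agree. -/
theorem carried_eq {r : V} (n m : ℕ) {u : V} {p : Option V} (h : Q.IsUp r u p)
    (hn : Fintype.card V ≤ n + Q.tree.dist u r) (hm : Fintype.card V ≤ m + Q.tree.dist u r) :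
    Q.carried n u p = Q.carried m u p := by
  induction n generalizing m u p with
  | zero =>
    have := Q.isTree.connected.dist_lt_card u r
    omega
  | succ n ih =>
    cases m with
    | zero =>
      have := Q.isTree.connected.dist_lt_card u r
      omega
    | succ m =>
      rw [carried, carried]
      congr 2
      refine Finset.biUnion_congr rfl fun i hi => ?_
      have := (h.mem_inNbrs.1 hi).2
      exact ih m (h.child hi) (by omega) (by omega)

variable (Q) in
/-- The attributes carried into `u` by the messages of all neighbours but `p`. -/
def carriedInto (u : V) (p : Option V) : Finset A :=
  (Q.inNbrs u p).biUnion fun i => Q.carried (Fintype.card V) i (some u)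

theorem IsUp.biUnion_carried_eq {r u : V} {p : Option V} (h : Q.IsUp r u p) {n : ℕ}
    (hn : Fintype.card V ≤ n + 1 + Q.tree.dist u r) :
    ((Q.inNbrs u p).biUnion fun i => Q.carried n i (some u)) = Q.carriedInto u p := by
  refine Finset.biUnion_congr rfl fun i hi => ?_
  have := (h.mem_inNbrs.1 hi).2
  exact carried_eq n _ (h.child hi) (by omega) (by omega)

theorem IsUp.carried_card {r u : V} {p : Option V} (h : Q.IsUp r u p) :
    Q.carried (Fintype.card V) u p = (Q.grp u ∪ Q.carriedInto u p) \ Q.marg u := by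
  rw [carried_eq (Fintype.card V) (Fintype.card V + 1) h (by omega) (by omega), carried,
    h.biUnion_carried_eq (by omega)]

theorem carried_subset_attrs (n : ℕ) (u : V) (p : Option V) : Q.carried n u p ⊆ Q.attrs := by
  induction n generalizing u p with
  | zero => simp [carried]
  | succ n ih =>
    rw [carried]
    refine Finset.sdiff_subset.trans (Finset.union_subset
      ((Q.grp_subset u).trans (bag_subset_attrs u)) ?_)
    exact Finset.biUnion_subset.2 fun i _ => ih i _

theorem messageAttrs_subset {r u v : V} (h : Q.IsUp r u (some v)) :
    Q.messageAttrs (Fintype.card V) u v ⊆ Q.bag u ∪ Q.carriedInto u (some v) := by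
  rw [messageAttrs, h.carried_card]
  refine Finset.union_subset (Finset.inter_subset_left.trans Finset.subset_union_left) ?_
  exact Finset.sdiff_subset.trans
    (Finset.union_subset_union (Q.grp_subset u) Finset.Subset.rfl)

variable (Q) in
/-- The bag that receives the message of `u` when messages are passed to `r`. -/
noncomputable def up (r u : V) : Option V :=
  if h : u ≠ r then some (Q.isTree.connected.exists_adj_dist_eq_add_one h).choose else none

theorem isUp_up (r u : V) : Q.IsUp r u (Q.up r u) := by
  unfold up
  split_ifs with h
  · exact Or.inr ⟨_, rfl, (Q.isTree.connected.exists_adj_dist_eq_add_one h).choose_spec⟩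
  · exact Or.inl ⟨rfl, not_not.1 h⟩

theorem up_eq_some_iff {r u w : V} :
    Q.up r u = some w ↔ Q.tree.Adj u w ∧ Q.tree.dist u r = Q.tree.dist w r + 1 := by
  rcases Q.isUp_up r u with ⟨h, rfl⟩ | ⟨w', h, h1, h2⟩
  · rw [h, SimpleGraph.dist_self]
    simp
  · rw [h, Option.some.injEq]
    exact ⟨fun h => h ▸ ⟨h1, h2⟩,
      fun h => Q.isTree.eq_of_adj_of_dist_eq_add_one h1 h2 h.1 h.2⟩

theorem mem_inNbrs_up_iff {r u i : V} : i ∈ Q.inNbrs u (Q.up r u) ↔ Q.up r i = some u := by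
  rw [(Q.isUp_up r u).mem_inNbrs, up_eq_some_iff]

@[simp] theorem up_self (r : V) : Q.up r r = none := by simp [up]

/-- Every bag but the root sends exactly one message. -/
theorem sum_inNbrs_up (r : V) (f : V → Option V → ℝ) :
    ∑ u, ∑ i ∈ Q.inNbrs u (Q.up r u), f i (some u) = ∑ i ∈ Finset.univ.erase r, f i (Q.up r i) := by
  have : ∀ i ∈ Finset.univ.erase r,
      f i (Q.up r i) = ∑ u ∈ Finset.univ.filter (fun u => Q.up r i = some u), f i (some u) := by
    intro i hi
    rcases Q.isUp_up r i with ⟨_, rfl⟩ | ⟨w, h, _⟩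
    · simp at hi
    · rw [h]
      simp [Finset.filter_eq]
  rw [Finset.sum_congr rfl this]
  refine Finset.sum_comm' fun u i => ?_
  rw [mem_inNbrs_up_iff]
  simp only [Finset.mem_univ, true_and, Finset.mem_filter, Finset.mem_erase, and_true]
  refine ⟨fun h => ⟨h, ?_⟩, fun h => h.1⟩
  rintro rfl
  simp at h

/-- Costs that exceed those of the children by at most `c` add up to the sum of `c`. -/
theorem le_sum_of_le_add_children (r : V) (F : V → Option V → ℝ) (c : V → ℝ)
    (h : ∀ u, F u (Q.up r u) ≤ c u + ∑ i ∈ Q.inNbrs u (Q.up r u), F i (some u)) :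
    F r none ≤ ∑ u, c u := by
  -- Summed over all bags, the cost of each non-root bag occurs once on either side and cancels.
  have h1 := Finset.sum_le_sum fun u (_ : u ∈ Finset.univ) => h u
  rw [Finset.sum_add_distrib, sum_inNbrs_up r F,
    ← Finset.add_sum_erase _ _ (Finset.mem_univ r), up_self] at h1
  linarith

theorem sum_card_inNbrs_le (r : V) :
    ∑ u, ((Q.inNbrs u (Q.up r u)).card : ℝ) ≤ Fintype.card V := by
  have := sum_inNbrs_up (Q := Q) r fun _ _ => 1
  simp only [Finset.sum_const, nsmul_eq_mul, mul_one] at this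
  rw [this]
  exact_mod_cast (Finset.card_le_card (Finset.erase_subset r Finset.univ))

/-- The attributes the query groups by reach the root. -/
theorem groupBy_subset (r : V) : Q.groupBy ⊆ Q.bag r ∪ Q.carriedInto r none := by
  intro a ha
  simp only [groupBy, Finset.mem_sdiff, Finset.mem_biUnion, Finset.mem_univ, true_and,
    not_exists] at ha
  obtain ⟨⟨v, hv⟩, hm⟩ := ha
  -- An attribute that is nowhere marginalized survives every step from its annotated bag to the
  -- root; induction on the distance to `r`.
  have step : ∀ n u, Q.tree.dist u r = n → a ∈ Q.grp u ∪ Q.carriedInto u (Q.up r u) →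
      a ∈ Q.grp r ∪ Q.carriedInto r none := by
    intro n
    induction n with
    | zero =>
      intro u hu hau
      rw [Q.isTree.connected.dist_eq_zero_iff] at hu
      subst hu
      simpa using hau
    | succ n ih =>
      intro u hu hau
      rcases Q.isUp_up r u with ⟨_, rfl⟩ | ⟨w, hw, hadj, hd⟩
      · simp at hu
      · refine ih w (by omega) (Finset.mem_union_right _ ?_)
        refine Finset.mem_biUnion.2 ⟨u, mem_inNbrs_up_iff.2 hw, ?_⟩
        have hup := Q.isUp_up r u
        rw [hw] at hup hau
        rw [hup.carried_card]
        exact Finset.mem_sdiff.2 ⟨hau, hm u⟩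
  exact Finset.union_subset_union (Q.grp_subset r) Finset.Subset.rfl
    (step _ v rfl (Finset.mem_union_left _ hv))

end Query

end SPJA

namespace SPJA

namespace Query

open Steps

variable {V A K : Type} [Fintype V] [LinearOrder V] [LinearOrder A] [CommSemiring K]
variable (Q : Query V A K)

/-! ### The message and the join computed at a bag -/

/-- The message `i → u`, computed with the depth bound `n`. -/
def msg (n : ℕ) (i u : V) : Steps (Table A K) := do
  let out ← Q.absorb n i (some u)
  Q.emit n i u out

/-- The tables that are joined at `u`. -/
def joinTables (n : ℕ) (u : V) (p : Option V) : List (Table A K) :=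
  (Q.select u).val :: ((Q.inNbrs u p).sort (· ≤ ·)).map fun i => (Q.msg n i u).val

theorem absorb_succ_val (n : ℕ) (u : V) (p : Option V) :
    (Q.absorb (n + 1) u p).val = (leapfrogTriejoin (Q.joinTables n u p)).val := by
  rw [absorb]
  simp only [bind_val, gather_val]
  rfl

theorem absorb_succ_time (n : ℕ) (u : V) (p : Option V) :
    (Q.absorb (n + 1) u p).time = (Q.size u + 1) +
      (∑ i ∈ Q.inNbrs u p, (Q.msg n i u).time + (Q.inNbrs u p).card + 1) +
      (leapfrogTriejoin (Q.joinTables n u p)).time := by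
  rw [absorb]
  simp only [bind_val, bind_time, gather_val, gather_time, select_time, Finset.sum_map_sort,
    Finset.length_sort, add_assoc]
  rfl

theorem length_joinTables (n : ℕ) (u : V) (p : Option V) :
    (Q.joinTables n u p).length = (Q.inNbrs u p).card + 1 := by
  simp [joinTables]

theorem joinTables_ne_nil (n : ℕ) (u : V) (p : Option V) : Q.joinTables n u p ≠ [] :=
  List.cons_ne_nil _ _

theorem sizeBound_nonneg (d : ℕ) (u : V) (p : Option V) : 0 ≤ Q.sizeBound d u p := by
  rw [sizeBound, selectivity_mul_size]
  positivity

theorem messageCost_nonneg (d : ℕ) (u : V) (p : Option V) : 0 ≤ Q.messageCost d u p := by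
  have h : 0 ≤ (Q.inNbrs u p).fold max (Q.selectivity u * Q.size u)
      fun x => Q.sizeBound d x (some u) := by
    rw [Finset.le_fold_max, selectivity_mul_size]
    exact Or.inl (Nat.cast_nonneg _)
  have := Q.sizeBound_nonneg d u p
  have := Real.log_nonneg (le_add_of_nonneg_right h : (1 : ℝ) ≤ _)
  rw [messageCost]
  positivity

variable {Q}

/-- A message as it should be. -/
structure IsMessage (Q : Query V A K) (d : ℕ) (i u : V) (T : Table A K) : Prop where
  attrs : T.attrs = Q.messageAttrs (Fintype.card V) i u
  stored : T.Stored Q.dom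
  length_le : (T.rows.length : ℝ) ≤ Q.sizeBound d i (some u)

section Node

variable {d n : ℕ} {r u : V} {p : Option V}

/-- The separator part of an incoming message already lies in `bag u`, so only carried attributes
enlarge the schema. -/
theorem joinAttrs_joinTables (hmsg : ∀ i ∈ Q.inNbrs u p, Q.IsMessage d i u (Q.msg n i u).val) :
    joinAttrs (Q.joinTables n u p) = Q.bag u ∪ Q.carriedInto u p := by
  ext a
  rw [mem_joinAttrs]
  simp only [joinTables, List.mem_cons, List.mem_map, Finset.mem_sort, exists_eq_or_imp,
    select_val, Finset.mem_union, carriedInto, Finset.mem_biUnion]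
  constructor
  · rintro (h | ⟨_, ⟨i, hi, rfl⟩, h⟩)
    · exact Or.inl h
    · rw [(hmsg i hi).attrs, messageAttrs, Finset.mem_union, Finset.mem_inter] at h
      exact h.imp (fun h => h.2) fun h => ⟨i, hi, h⟩
  · rintro (h | ⟨i, hi, h⟩)
    · exact Or.inl h
    · refine Or.inr ⟨_, ⟨i, hi, rfl⟩, ?_⟩
      rw [(hmsg i hi).attrs, messageAttrs]
      exact Finset.mem_union_right _ h

theorem card_joinAttrs_joinTables
    (hmsg : ∀ i ∈ Q.inNbrs u p, Q.IsMessage d i u (Q.msg n i u).val) :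
    (joinAttrs (Q.joinTables n u p)).card = (Q.bag u).card + Q.numCarried u p := by
  rw [joinAttrs_joinTables hmsg, Finset.union_comm, ← Finset.card_sdiff_add_card, add_comm]
  rfl

theorem joinTables_stored (hmsg : ∀ i ∈ Q.inNbrs u p, Q.IsMessage d i u (Q.msg n i u).val) :
    ∀ T ∈ Q.joinTables n u p, T.Stored Q.dom := by
  intro T hT
  rcases List.mem_cons.1 hT with rfl | hT
  · exact Q.select_stored u
  · obtain ⟨i, hi, rfl⟩ := List.mem_map.1 hT
    exact (hmsg i ((Finset.mem_sort _).1 hi)).stored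

variable (Q d u p) in
/-- The largest size of a table that is joined at `u`, according to the size bounds. -/
noncomputable def maxInput : ℝ :=
  (Q.inNbrs u p).fold max (Q.selectivity u * Q.size u) fun x => Q.sizeBound d x (some u)

theorem joinTables_length_le (hmsg : ∀ i ∈ Q.inNbrs u p, Q.IsMessage d i u (Q.msg n i u).val) :
    ∀ T ∈ Q.joinTables n u p, (T.rows.length : ℝ) ≤ Q.maxInput d u p := by
  intro T hT
  rw [maxInput, Finset.le_fold_max]
  rcases List.mem_cons.1 hT with rfl | hT
  · left
    rw [selectivity_mul_size, select_val]
    rfl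
  · obtain ⟨i, hi, rfl⟩ := List.mem_map.1 hT
    have hi' := (Finset.mem_sort _).1 hi
    exact Or.inr ⟨i, hi', (hmsg i hi').length_le⟩

theorem carriedInto_subset_attrs : Q.carriedInto u p ⊆ Q.attrs :=
  Finset.biUnion_subset.2 fun i _ => carried_subset_attrs _ i _

theorem domProd_le (hd : ∀ a ∈ Q.attrs, (Q.dom a).card ≤ d) :
    domProd Q.dom (Q.domWeight u) ((Q.bag u ∪ Q.carriedInto u p).sort (· ≤ ·)) ≤
      (d : ℝ) ^ Q.numCarried u p := by
  rw [domProd, Finset.prod_map_sort]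
  have h : ∀ a ∈ Q.bag u ∪ Q.carriedInto u p, ((Q.dom a).card : ℝ) ^ Q.domWeight u a ≤
      if a ∈ Q.bag u then 1 else (d : ℝ) := by
    intro a ha
    unfold domWeight
    split_ifs with h
    · simp
    · rw [Real.rpow_one]
      exact_mod_cast hd a (carriedInto_subset_attrs ((Finset.mem_union.1 ha).resolve_left h))
  refine (Finset.prod_le_prod (fun a _ => by positivity) h).trans (le_of_eq ?_)
  rw [Finset.prod_ite, Finset.prod_const_one, one_mul, Finset.prod_const]
  congr 2
  ext a
  simp only [Finset.mem_filter, Finset.mem_union, Finset.mem_sdiff, carriedInto]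
  tauto

/-- Messages have weight 0 and drop out. Attributes of the bag have domain weight 0 and contribute
1; each carried attribute outside it contributes at most `d`. -/
theorem potential_le (hd : ∀ a ∈ Q.attrs, (Q.dom a).card ≤ d)
    (hmsg : ∀ i ∈ Q.inNbrs u p, Q.IsMessage d i u (Q.msg n i u).val) :
    domProd Q.dom (Q.domWeight u) ((joinAttrs (Q.joinTables n u p)).sort (· ≤ ·)) *
        powProd (1 :: List.replicate (Q.inNbrs u p).card 0)
          ((Q.joinTables n u p).map (·.rows.length)) ≤ Q.sizeBound d u p := by
  rw [joinAttrs_joinTables hmsg, joinTables, List.map_cons, powProd_cons, powProd_replicate_zero,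
    Real.rpow_one, mul_one, sizeBound, selectivity_mul_size, select_val]
  exact mul_le_mul_of_nonneg_right (domProd_le hd) (by positivity)

/-- An attribute of the bag is covered by the relation of `u`, any other by its own domain. -/
theorem joinTables_cover (a : A) :
    1 ≤ flagSum (1 :: List.replicate (Q.inNbrs u p).card 0) (flags a (Q.joinTables n u p)) +
      Q.domWeight u a := by
  have h0 : ∀ k (fs : List Bool), 0 ≤ flagSum (List.replicate k 0) fs := by
    intro k
    induction k with
    | zero => simp
    | succ k ih =>
      intro fs
      cases fs with
      | nil => simp
      | cons f fs =>
        rw [List.replicate_succ, flagSum_cons]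
        simpa using ih fs
  simp only [joinTables, flags, List.map_cons, flagSum_cons, select_val, decide_eq_true_eq,
    domWeight]
  have := h0 (Q.inNbrs u p).card (((Q.inNbrs u p).sort (· ≤ ·)).map (fun i =>
    (Q.msg n i u).val) |>.map fun T => decide (a ∈ T.attrs))
  split_ifs <;> linarith

theorem joinTables_weights_nonneg (k : ℕ) : ∀ x ∈ (1 : ℝ) :: List.replicate k 0, 0 ≤ x := by
  intro x hx
  rcases List.mem_cons.1 hx with rfl | hx
  · exact zero_le_one
  · rw [List.eq_of_mem_replicate hx]

theorem joinTables_weights_length :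
    ((1 : ℝ) :: List.replicate (Q.inNbrs u p).card 0).length = (Q.joinTables n u p).length := by
  simp [length_joinTables]

theorem join_length_le (hd : ∀ a ∈ Q.attrs, (Q.dom a).card ≤ d)
    (hmsg : ∀ i ∈ Q.inNbrs u p, Q.IsMessage d i u (Q.msg n i u).val) :
    ((leapfrogTriejoin (Q.joinTables n u p)).val.length : ℝ) ≤ Q.sizeBound d u p :=
  (leapfrogTriejoin_length_le (joinTables_stored hmsg) (joinTables_weights_nonneg _)
    joinTables_weights_length domWeight_nonneg fun a _ => joinTables_cover a).trans
    (potential_le hd hmsg)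

theorem messageCost_eq (hmsg : ∀ i ∈ Q.inNbrs u p, Q.IsMessage d i u (Q.msg n i u).val) :
    ((Q.joinTables n u p).length : ℝ) * (joinAttrs (Q.joinTables n u p)).card *
      Q.sizeBound d u p * Real.log (1 + Q.maxInput d u p) = Q.messageCost d u p := by
  rw [length_joinTables, card_joinAttrs_joinTables hmsg, messageCost, maxInput]
  push_cast
  rfl

theorem absorb_time_le (hd : ∀ a ∈ Q.attrs, (Q.dom a).card ≤ d)
    (hmsg : ∀ i ∈ Q.inNbrs u p, Q.IsMessage d i u (Q.msg n i u).val) :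
    ((Q.absorb (n + 1) u p).time : ℝ) ≤ Q.size u + 4 * (Q.inNbrs u p).card + 5 +
      60 * Q.messageCost d u p + ∑ i ∈ Q.inNbrs u p, ((Q.msg n i u).time : ℝ) := by
  have h := leapfrogTriejoin_time_le (Q.joinTables_ne_nil n u p) (joinTables_stored hmsg)
    (joinTables_length_le hmsg) (joinTables_weights_nonneg _) joinTables_weights_length
    domWeight_nonneg (fun a _ => joinTables_cover a) (potential_le hd hmsg)
  rw [messageCost_eq hmsg, length_joinTables] at h
  rw [absorb_succ_time]
  push_cast at h ⊢
  linarith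

theorem aggregate_time_le (hd : ∀ a ∈ Q.attrs, (Q.dom a).card ≤ d)
    (hmsg : ∀ i ∈ Q.inNbrs u p, Q.IsMessage d i u (Q.msg n i u).val) {S : Finset A}
    (hS : S ⊆ Q.bag u ∪ Q.carriedInto u p) :
    ((hashAggregate S [] (Q.absorb (n + 1) u p).val).time : ℝ) ≤
      2 + 3 * Q.messageCost d u p := by
  rw [absorb_succ_val, ← messageCost_eq hmsg]
  refine hashAggregate_join_time_le (Q.joinTables_ne_nil n u p) (joinTables_stored hmsg)
    (joinTables_length_le hmsg) (join_length_le hd hmsg) S ?_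
  rw [joinAttrs_joinTables hmsg]
  exact Finset.card_le_card hS

theorem sort_time_le (hd : ∀ a ∈ Q.attrs, (Q.dom a).card ≤ d)
    (hmsg : ∀ i ∈ Q.inNbrs u p, Q.IsMessage d i u (Q.msg n i u).val) {S : Finset A}
    (hS : S ⊆ Q.bag u ∪ Q.carriedInto u p) :
    ((sortRows S (hashAggregate S [] (Q.absorb (n + 1) u p).val).val).time : ℝ) ≤
      1 + 15 * Q.messageCost d u p := by
  rw [absorb_succ_val, ← messageCost_eq hmsg]
  refine sortRows_join_time_le (Q.joinTables_ne_nil n u p) (joinTables_stored hmsg)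
    (joinTables_length_le hmsg) (join_length_le hd hmsg) S ?_ _ ?_
  · rw [joinAttrs_joinTables hmsg]
    exact Finset.card_le_card hS
  · simpa using hashAggregate_length_le S [] (leapfrogTriejoin (Q.joinTables n u p)).val

theorem IsUp.messageAttrs_eq {v : V} (h : Q.IsUp r u (some v))
    (hn : Fintype.card V ≤ n + Q.tree.dist u r) :
    Q.messageAttrs n u v = Q.messageAttrs (Fintype.card V) u v := by
  rw [messageAttrs, messageAttrs, carried_eq n (Fintype.card V) h hn (by omega)]

theorem IsUp.isMessage_succ {v : V} (h : Q.IsUp r u (some v))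
    (hn : Fintype.card V ≤ n + 1 + Q.tree.dist u r) (hd : ∀ a ∈ Q.attrs, (Q.dom a).card ≤ d)
    (hmsg : ∀ i ∈ Q.inNbrs u (some v), Q.IsMessage d i u (Q.msg n i u).val) :
    Q.IsMessage d u v (Q.msg (n + 1) u v).val := by
  simp only [msg, emit, bind_val, pure_val, h.messageAttrs_eq hn]
  obtain ⟨-, hperm, hsorted⟩ := sortRows_spec (Q.messageAttrs (Fintype.card V) u v)
    (hashAggregate (Q.messageAttrs (Fintype.card V) u v) []
      (Q.absorb (n + 1) u (some v)).val).val
  refine ⟨rfl, ⟨hsorted, fun x hx => ?_⟩, ?_⟩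
  · refine RowsIn.hashAggregate (dom := Q.dom) (t := []) (by simp [RowsIn]) ?_ x
      (hperm.mem_iff.1 hx)
    intro y hy a ha
    rw [absorb_succ_val] at hy
    refine leapfrogTriejoin_rowsIn (joinTables_stored hmsg) y hy a ?_
    rw [joinAttrs_joinTables hmsg]
    exact messageAttrs_subset h ha
  · change ((sortRows _ _).val.length : ℝ) ≤ _
    rw [hperm.length_eq]
    refine le_trans ?_ (join_length_le hd hmsg)
    rw [absorb_succ_val]
    have := hashAggregate_length_le (Q.messageAttrs (Fintype.card V) u v) []
      (leapfrogTriejoin (Q.joinTables n u (some v))).val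
    rw [List.length_nil, zero_add] at this
    exact_mod_cast this

theorem IsUp.isMessage {v : V} (h : Q.IsUp r u (some v))
    (hn : Fintype.card V ≤ n + Q.tree.dist u r) (hd : ∀ a ∈ Q.attrs, (Q.dom a).card ≤ d) :
    Q.IsMessage d u v (Q.msg n u v).val := by
  induction n generalizing u v with
  | zero =>
    have := Q.isTree.connected.dist_lt_card u r
    omega
  | succ n ih =>
    refine h.isMessage_succ hn hd fun i hi => ih (h.child hi) ?_
    have := (h.mem_inNbrs.1 hi).2
    omega

theorem IsUp.isMessage_child (h : Q.IsUp r u p) (hn : Fintype.card V ≤ n + 1 + Q.tree.dist u r)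
    (hd : ∀ a ∈ Q.attrs, (Q.dom a).card ≤ d) :
    ∀ i ∈ Q.inNbrs u p, Q.IsMessage d i u (Q.msg n i u).val := fun i hi => by
  have := (h.mem_inNbrs.1 hi).2
  exact (h.child hi).isMessage (by omega) hd

/-- The constants add up over join, aggregation and sort: 78 = 60 + 3 + 15 and 8 = 5 + 2 + 1. -/
theorem IsUp.msg_time_le {v : V} (h : Q.IsUp r u (some v))
    (hn : Fintype.card V ≤ n + 1 + Q.tree.dist u r) (hd : ∀ a ∈ Q.attrs, (Q.dom a).card ≤ d) :
    ((Q.msg (n + 1) u v).time : ℝ) ≤ Q.size u + 4 * (Q.inNbrs u (some v)).card + 8 +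
      78 * Q.messageCost d u (some v) +
        ∑ i ∈ Q.inNbrs u (some v), ((Q.msg n i u).time : ℝ) := by
  have hmsg := h.isMessage_child hn hd
  have h1 := absorb_time_le hd hmsg
  have h2 := aggregate_time_le hd hmsg (messageAttrs_subset h)
  have h3 := sort_time_le hd hmsg (messageAttrs_subset h)
  rw [msg]
  simp only [emit, bind_time, pure_time, h.messageAttrs_eq hn]
  push_cast
  linarith

/-- The root does not sort, but it is given the same constants as the messages so that all bags fit
one recurrence. -/
theorem messagePassing_time_le_add (hd : ∀ a ∈ Q.attrs, (Q.dom a).card ≤ d)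
    (hn : Fintype.card V = n + 1) :
    ((Q.messagePassing r).time : ℝ) ≤ Q.size r + 4 * (Q.inNbrs r none).card + 8 +
      78 * Q.messageCost d r none + ∑ i ∈ Q.inNbrs r none, ((Q.msg n i r).time : ℝ) := by
  have hup : Q.IsUp r r none := Or.inl ⟨rfl, rfl⟩
  have hmsg := hup.isMessage_child (n := n) (by omega) hd
  have h1 := absorb_time_le hd hmsg
  have h2 := aggregate_time_le hd hmsg (groupBy_subset r)
  have hm := Q.messageCost_nonneg d r none
  rw [messagePassing, hn]
  simp only [bind_time]
  push_cast
  linarith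

end Node

end Query

end SPJA

namespace SPJA

/-! ### Total costs of message passing and naive execution. -/

theorem powProd_map_map {ι : Type} (l : List ι) (x : ι → ℝ) (f : ι → ℕ) :
    powProd (l.map x) (l.map f) = (l.map fun i => (f i : ℝ) ^ x i).prod := by
  induction l with
  | nil => simp
  | cons i l ih => simp [ih]

theorem flagSum_map_map {ι : Type} (l : List ι) (x : ι → ℝ) (f : ι → Bool) :
    flagSum (l.map x) (l.map f) = (l.map fun i => if f i then x i else 0).sum := by
  induction l with
  | nil => simp
  | cons i l ih => simp [ih]

namespace Query

open Steps

variable {V A K : Type} [Fintype V] [LinearOrder V] [LinearOrder A] [CommSemiring K]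

theorem message_length_le (Q : Query V A K) {d : ℕ} (hd : ∀ a ∈ Q.attrs, (Q.dom a).card ≤ d)
    {u v : V} (h : Q.tree.Adj u v) :
    ((Q.message u v).val.rows.length : ℝ) ≤ Q.sizeBound d u (some v) := by
  -- Taking the receiver itself as the root makes the edge point upwards.
  have hup : Q.IsUp v u (some v) :=
    Or.inr ⟨v, rfl, h, by simp [SimpleGraph.dist_eq_one_iff_adj.2 h]⟩
  exact (hup.isMessage (n := Fintype.card V) (by omega) hd).length_le

theorem messagePassing_time_le (Q : Query V A K) {d : ℕ}
    (hd : ∀ a ∈ Q.attrs, (Q.dom a).card ≤ d) (r : V) :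
    ((Q.messagePassing r).time : ℝ) ≤
      100 * ∑ u, (Q.messageCost d u (Q.up r u) + (Q.size u : ℝ)) := by
  -- The depth bound left at `u` is the number of bags minus the distance of `u` to the root, which
  -- is what the recursion started at `r` has left there.
  let F : V → Option V → ℝ := fun u p =>
    match p with
    | none => (Q.messagePassing r).time
    | some v => (Q.msg (Fintype.card V - Q.tree.dist u r) u v).time
  have key := le_sum_of_le_add_children r F (fun u => Q.size u +
    4 * ((Q.inNbrs u (Q.up r u)).card : ℝ) + 8 + 78 * Q.messageCost d u (Q.up r u)) fun u => by
      have hup := Q.isUp_up r u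
      have hlt := Q.isTree.connected.dist_lt_card u r
      obtain ⟨n, hn⟩ : ∃ n, Fintype.card V - Q.tree.dist u r = n + 1 :=
        Nat.exists_eq_succ_of_ne_zero (by omega)
      have hF : ∀ i ∈ Q.inNbrs u (Q.up r u), F i (some u) = (Q.msg n i u).time := fun i hi => by
        have := (hup.mem_inNbrs.1 hi).2
        simp only [F]
        rw [show Fintype.card V - Q.tree.dist i r = n by omega]
      rw [Finset.sum_congr rfl hF]
      rcases hup with ⟨h, rfl⟩ | ⟨w, h, hadj, hdist⟩
      · rw [SimpleGraph.dist_self] at hn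
        rw [h]
        exact messagePassing_time_le_add hd (by omega)
      · have hup := Q.isUp_up r u
        rw [h] at hup ⊢
        simp only [F, hn]
        exact hup.msg_time_le (by omega) hd
  refine key.trans ?_
  -- Edges and bags number at most the total size of the relations, so the additive part is at most
  -- 1 + 4 + 8 = 13 times that size.
  have h1 := sum_card_inNbrs_le (Q := Q) r
  have h2 : (Fintype.card V : ℝ) ≤ ∑ u, (Q.size u : ℝ) := by
    have : ∑ _u : V, (1 : ℝ) ≤ ∑ u, (Q.size u : ℝ) :=
      Finset.sum_le_sum fun u _ => by exact_mod_cast Q.one_le_size u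
    simpa using this
  have h3 : 0 ≤ ∑ u, Q.messageCost d u (Q.up r u) :=
    Finset.sum_nonneg fun u _ => Q.messageCost_nonneg d u _
  simp only [Finset.sum_add_distrib, ← Finset.mul_sum, Finset.sum_const, Finset.card_univ,
    nsmul_eq_mul] at *
  linarith

/-! ### Naive execution -/

/-- The tables that are joined by the naive execution. -/
def selectedTables (Q : Query V A K) : List (Table A K) :=
  (Finset.univ.sort (· ≤ ·)).map fun v => (Q.select v).val

variable {Q : Query V A K}

theorem length_selectedTables : Q.selectedTables.length = Fintype.card V := by
  simp [selectedTables]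

theorem selectedTables_ne_nil : Q.selectedTables ≠ [] := by
  have := Q.isTree.connected.nonempty
  rw [← List.length_pos_iff, length_selectedTables]
  exact Fintype.card_pos

theorem selectedTables_stored : ∀ T ∈ Q.selectedTables, T.Stored Q.dom := by
  intro T hT
  obtain ⟨v, -, rfl⟩ := List.mem_map.1 hT
  exact Q.select_stored v

theorem joinAttrs_selectedTables : joinAttrs Q.selectedTables = Q.attrs := by
  ext a
  rw [mem_joinAttrs]
  simp [selectedTables, attrs, select_val]

theorem selectedTables_length_le :
    ∀ T ∈ Q.selectedTables, (T.rows.length : ℝ) ≤ Q.maxSelected := by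
  intro T hT
  obtain ⟨v, -, rfl⟩ := List.mem_map.1 hT
  rw [maxSelected, Finset.le_fold_max]
  refine Or.inr ⟨v, Finset.mem_univ v, ?_⟩
  rw [selectivity_mul_size, select_val]
  rfl

theorem groupBy_card_le : Q.groupBy.card ≤ (joinAttrs Q.selectedTables).card := by
  rw [joinAttrs_selectedTables]
  exact Finset.card_le_card (Finset.sdiff_subset.trans
    (Finset.biUnion_mono fun u _ => Q.grp_subset u))

theorem naive_time : Q.naive.time =
    (∑ v, (Q.size v + 1) + Fintype.card V + 1) + (leapfrogTriejoin Q.selectedTables).time +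
      (hashAggregate Q.groupBy [] (leapfrogTriejoin Q.selectedTables).val).time := by
  rw [naive]
  simp only [bind_time, gather_val, gather_time, select_time, Finset.sum_map_sort,
    Finset.length_sort, Finset.card_univ, add_assoc]
  rfl

theorem naive_time_le_of_cover {x : V → ℝ} (hx : Q.IsFractionalEdgeCover x) :
    (Q.naive.time : ℝ) ≤ 9 * ∑ v, (Q.size v : ℝ) +
      63 * ((Fintype.card V : ℝ) * Q.attrs.card * (∏ v, (Q.selectivity v * Q.size v) ^ x v) *
        Real.log (1 + Q.maxSelected)) := by
  have hpow : powProd ((Finset.univ.sort (· ≤ ·)).map x)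
      (Q.selectedTables.map (·.rows.length)) = ∏ v, (Q.selectivity v * Q.size v) ^ x v := by
    rw [selectedTables, List.map_map, powProd_map_map, Finset.prod_map_sort]
    refine Finset.prod_congr rfl fun v _ => ?_
    rw [selectivity_mul_size]
    simp only [Function.comp, select_val]
    rfl
  have hW : domProd Q.dom (fun _ => 0) ((joinAttrs Q.selectedTables).sort (· ≤ ·)) *
      powProd ((Finset.univ.sort (· ≤ ·)).map x) (Q.selectedTables.map (·.rows.length)) ≤
      ∏ v, (Q.selectivity v * Q.size v) ^ x v := by
    rw [hpow, domProd_zero, one_mul]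
  have hxs : ∀ z ∈ (Finset.univ.sort (· ≤ ·)).map x, 0 ≤ z := fun z hz => by
    obtain ⟨v, -, rfl⟩ := List.mem_map.1 hz
    exact hx.1 v
  have hcov : ∀ a ∈ joinAttrs Q.selectedTables,
      1 ≤ flagSum ((Finset.univ.sort (· ≤ ·)).map x) (flags a Q.selectedTables) + 0 := by
    intro a ha
    rw [joinAttrs_selectedTables] at ha
    rw [flags, selectedTables, List.map_map, flagSum_map_map, Finset.sum_map_sort, add_zero]
    refine (hx.2 a ha).trans (le_of_eq ?_)
    rw [Finset.sum_filter]
    simp [select_val]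
  have hlen : ((Finset.univ.sort (· ≤ ·)).map x).length = Q.selectedTables.length := by
    simp [selectedTables]
  have h1 := leapfrogTriejoin_time_le selectedTables_ne_nil selectedTables_stored
    selectedTables_length_le hxs hlen (fun _ => le_rfl) hcov hW
  have h2 := hashAggregate_join_time_le selectedTables_ne_nil selectedTables_stored
    selectedTables_length_le ((leapfrogTriejoin_length_le selectedTables_stored hxs hlen
      (fun _ => le_rfl) hcov).trans hW) Q.groupBy groupBy_card_le
  rw [joinAttrs_selectedTables, length_selectedTables] at h1 h2
  have h3 : (Fintype.card V : ℝ) ≤ ∑ u, (Q.size u : ℝ) := by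
    have : ∑ _u : V, (1 : ℝ) ≤ ∑ u, (Q.size u : ℝ) :=
      Finset.sum_le_sum fun u _ => by exact_mod_cast Q.one_le_size u
    simpa using this
  have h4 : (1 : ℝ) ≤ Fintype.card V := by
    have := Q.isTree.connected.nonempty
    exact_mod_cast Fintype.card_pos (α := V)
  rw [naive_time]
  push_cast
  simp only [Finset.sum_add_distrib, Finset.sum_const, Finset.card_univ, nsmul_eq_mul, mul_one]
  linarith

theorem naive_time_le (Q : Query V A K) :
    (Q.naive.time : ℝ) ≤ 100 * ((Fintype.card V : ℝ) * (Q.attrs.card : ℝ) * Q.edgeCoverBound *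
      Real.log (1 + Q.maxSelected) + ∑ v, (Q.size v : ℝ)) := by
  have hone : Q.IsFractionalEdgeCover fun _ => 1 := by
    refine ⟨fun _ => zero_le_one, fun a ha => ?_⟩
    obtain ⟨v, -, hv⟩ := Finset.mem_biUnion.1 ha
    rw [Finset.sum_const, nsmul_eq_mul, mul_one]
    exact_mod_cast Finset.card_pos.2 ⟨v, by simpa using hv⟩
  have hM : 0 ≤ Q.maxSelected := (Finset.le_fold_max _).2 (Or.inl le_rfl)
  have hℓ : 0 ≤ Real.log (1 + Q.maxSelected) := Real.log_nonneg (by linarith)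
  have hsize : 0 ≤ ∑ v, (Q.size v : ℝ) := by positivity
  have hρ : 0 ≤ Q.edgeCoverBound := by
    refine Real.sInf_nonneg ?_
    rintro _ ⟨x, -, rfl⟩
    refine Finset.prod_nonneg fun v _ => Real.rpow_nonneg ?_ _
    rw [selectivity_mul_size]
    positivity
  set B : ℝ := 63 * ((Fintype.card V : ℝ) * Q.attrs.card * Real.log (1 + Q.maxSelected)) with hB
  have hB0 : 0 ≤ B := by positivity
  have hle : ∀ x, Q.IsFractionalEdgeCover x → (Q.naive.time : ℝ) ≤
      9 * ∑ v, (Q.size v : ℝ) + B * ∏ v, (Q.selectivity v * Q.size v) ^ x v := fun x hx => by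
    refine (naive_time_le_of_cover hx).trans (le_of_eq ?_)
    rw [hB]
    ring
  have hmain : (Q.naive.time : ℝ) ≤ 9 * ∑ v, (Q.size v : ℝ) + B * Q.edgeCoverBound := by
    rcases hB0.eq_or_lt with h0 | hpos
    · have := hle _ hone
      rw [← h0, zero_mul] at this ⊢
      exact this
    · have : ((Q.naive.time : ℝ) - 9 * ∑ v, (Q.size v : ℝ)) / B ≤ Q.edgeCoverBound := by
        refine le_csInf ⟨_, _, hone, rfl⟩ ?_
        rintro _ ⟨x, hx, rfl⟩
        rw [div_le_iff₀ hpos]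
        linarith [hle x hx]
      rw [div_le_iff₀ hpos] at this
      linarith
  have : 0 ≤ (Fintype.card V : ℝ) * Q.attrs.card * Q.edgeCoverBound *
      Real.log (1 + Q.maxSelected) := by positivity
  rw [hB] at hmain
  linarith

end Query

end SPJA

theorem mainTheorem2 :
    ∃ C : ℝ, 0 < C ∧
      ∀ (V A K : Type) [Fintype V] [LinearOrder V] [LinearOrder A] [CommSemiring K]
        (Q : SPJA.Query V A K),
        ((Q.naive.time : ℝ) ≤ C *
          ((Fintype.card V : ℝ) * (Q.attrs.card : ℝ) * Q.edgeCoverBound *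
              Real.log (1 + Q.maxSelected)
            + ∑ v, (Q.size v : ℝ))) ∧
        ∀ d : ℕ, (∀ a ∈ Q.attrs, (Q.dom a).card ≤ d) →
          (∀ u v : V, Q.tree.Adj u v →
            ((Q.message u v).val.rows.length : ℝ) ≤ Q.sizeBound d u (some v)) ∧
          ∀ r : V, ((Q.messagePassing r).time : ℝ) ≤ C *
            ∑ e ∈ insert (r, (none : Option V)) ((Q.traversed r).image fun e => (e.1, some e.2)),
              (Q.messageCost d e.1 e.2 + (Q.size e.1 : ℝ)) := by
  refine ⟨100, by norm_num, fun V A K _ _ _ _ Q => ⟨Q.naive_time_le, fun d hd =>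
    ⟨fun u v h => Q.message_length_le hd h, fun r => (Q.messagePassing_time_le hd r).trans ?_⟩⟩⟩
  refine mul_le_mul_of_nonneg_left ?_ (by norm_num)
  have hinj : Set.InjOn (fun u => (u, Q.up r u)) (Finset.univ : Finset V) :=
    fun u _ v _ h => congrArg Prod.fst h
  rw [← Finset.sum_image (g := fun u => (u, Q.up r u))
    (f := fun e => Q.messageCost d e.1 e.2 + (Q.size e.1 : ℝ)) hinj]
  refine Finset.sum_le_sum_of_subset_of_nonneg (fun e he => ?_) fun e _ _ =>
    add_nonneg (Q.messageCost_nonneg d e.1 e.2) (Nat.cast_nonneg _)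
  obtain ⟨u, -, rfl⟩ := Finset.mem_image.1 he
  rcases Q.isUp_up r u with ⟨h, rfl⟩ | ⟨w, h, hw⟩
  · simp only [h]
    exact Finset.mem_insert_self _ _
  · simp only [h]
    refine Finset.mem_insert_of_mem (Finset.mem_image.2 ⟨(u, w), ?_, rfl⟩)
    simpa [SPJA.Query.traversed] using hw
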